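/- Let $S\subseteq\omega_1$ be a set of limit ordinals, let $F$ be a field, and let $D$ be a filter on $\omega$ containing all cofinite subsets of $\omega$. Let $V$ be the $F$-vector space freely generated by $\{x_\xi:\xi<\omega_1\}$. For $y=\sum_\xi e_\xi x_\xi\in V$ put $\operatorname{supp}(y)=\{\xi: e_\xi\neq 0\}$, and for $f:\omega_1\to F$ put $f(y)=\sum_\xi e_\xi f(\xi)$. Let $\bar y=\langle y_{\delta,n}:\delta\in S,\ n<\omega\rangle$ be a $V$-ladder system on $S$, that is, for every $\delta\in S$: $\bigcup_n\operatorname{supp}(y_{\delta,n})\subseteq\delta$; the sequence $\langle\min\operatorname{supp}(y_{\delta,n}):n<\omega\rangle$ is increasing with limit $\delta$; and $\operatorname{supp}(y_{\delta,n})\not\subseteq\bigcup_{m<n}\operatorname{supp}(y_{\delta,m})$ for all $n<\omega$. An $F$-colouring on $S$ is a function $a:S\to{}^\omega F$, $a(\delta)=\langle a_{\delta,n}:n<\omega\rangle$; the colourings form an $F$-vector space $\mathrm{Col}$ with the componentwise operations. A colouring $a$ is uniform if there is $f:\omega_1\to F$ with $\{n<\omega:f(y_{\delta,n})=a_{\delta,n}\}\in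 D$ for all $\delta\in S$; the uniform colourings form a subspace $\mathrm{Unif}$ of $\mathrm{Col}$. Colourings $a,b$ are equivalent if $a-b\in\mathrm{Unif}$. Let ${}^{\omega}F_D=\{u\in{}^\omega F:\{n:u(n)=0\}\in D\}$. For a colouring $a$, the coded model $M_a$ has as its domain the disjoint union of $S\times{}^{\omega}F_D$ and $V\times F$, and has the following relations: the unary relations $R_y=\{y\}\times F$ for $y\in V$ and $R_\delta=\{\delta\}\times{}^{\omega}F_D$ for $\delta\in S$; and the graphs of the partial functions $$\mathrm{Pr}_n(\delta,u)=(y_{\delta,n},\,a_{\delta,n}+u(n))\ (n<\omega),\qquad +_b(y,c)=(y,c+b)\ (b\in F),\qquad +_u(\delta,v)=(\delta,v+u)\ (u\in{}^{\omega}F_D),$$ $$(y,b)+(z,c)=(y+z,\,b+c),\qquad \cdot_e(y,b)=(ey,\,eb)\ (e\in F).$$ All the $M_a$ have the same vocabulary $\tau$, with one relation symbol for each relation listed; only the relations $\mathrm{Pr}_n$ depend on $a$. For a model $M$ of cardinality $\kappa$, let $\mathrm{No}(M)$ be the number of isomorphism classes of models $N$ (of the vocabulary of $M$) of cardinality $\kappa$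 which satisfy the same $L_{\infty\kappa}$-sentences as $M$; here $L_{\infty\kappa}$ allows conjunctions and disjunctions of arbitrary sets of formulas and quantification over blocks of fewer than $\kappa$ variables. Then: (i) For all colourings $a,b$: $M_a\cong M_b$ if and only if $a$ and $b$ are equivalent. (ii) If $N$ is a model of vocabulary $\tau$ with $|N|=\aleph_1$ and $N$ is $L_{\infty\omega_1}$-equivalent to $M_a$ for some colouring $a$, then $N\cong M_b$ for some colouring $b$. (iii) For each colouring $a$ such that $|M_a|=\aleph_1$: $\mathrm{No}(M_a)=|\mathrm{Col}/\mathrm{Unif}|$. -/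

import Mathlib

open scoped FirstOrder Cardinal Ordinal

universe u v w x

namespace LadderModels

/-! ### Infinitary logic -/

/-- Formulas of the infinitary language `L_{∞κ}` with free variables indexed by `α`: atomic
formulas, negation, conjunctions over arbitrary (small) index sets, and universal quantification
over blocks of fewer than `κ` variables simultaneously.  Disjunctions and existential quantifiers
are obtained with the help of negation. -/
inductive InfFormula (L : FirstOrder.Language.{u, v}) (κ : Cardinal.{w}) :
    Type w → Type (max u v (w + 1))
  | equal {α : Type w} (s t : L.Term α) : InfFormula L κ α
  | rel {α : Type w} {n : ℕ} (R : L.Relations n) (ts : Fin n → L.Term α) : InfFormula L κ α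
  | neg {α : Type w} (φ : InfFormula L κ α) : InfFormula L κ α
  | conj {α : Type w} (ι : Type w) (φ : ι → InfFormula L κ α) : InfFormula L κ α
  | all {α : Type w} (β : Type w) (hβ : Cardinal.mk β < κ) (φ : InfFormula L κ (α ⊕ β)) :
      InfFormula L κ α

/-- Satisfaction of a formula of `L_{∞κ}` in a structure `M` under an assignment of the free
variables. -/
def InfFormula.Realize {L : FirstOrder.Language.{u, v}} {κ : Cardinal.{w}} (M : Type x)
    [L.Structure M] : {α : Type w} → InfFormula L κ α → (α → M) → Prop
  | _, .equal s t, e => s.realize e = t.realize e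
  | _, .rel R ts, e => FirstOrder.Language.Structure.RelMap R (fun i => (ts i).realize e)
  | _, .neg φ, e => ¬ φ.Realize M e
  | _, .conj ι φ, e => ∀ i : ι, (φ i).Realize M e
  | _, .all β _ φ, e => ∀ b : β → M, φ.Realize M (Sum.elim e b)

/-- `M` and `N` satisfy the same sentences of `L_{∞κ}`. -/
def InfEquiv (L : FirstOrder.Language.{u, v}) (κ : Cardinal.{w}) (M N : Type w)
    [L.Structure M] [L.Structure N] : Prop :=
  ∀ φ : InfFormula L κ PEmpty.{w + 1},
    φ.Realize M PEmpty.elim ↔ φ.Realize N PEmpty.elim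

/-- `No(M)` for a structure `M` of cardinality `κ`: the number of isomorphism classes of structures
of cardinality `κ` that are `L_{∞κ}`-equivalent to `M`. -/
noncomputable def No (L : FirstOrder.Language.{u, v}) (M : Type w) [L.Structure M] : Cardinal :=
  Cardinal.mk {c : Quotient (FirstOrder.Language.equivSetoid (L := L)) |
    ∃ N : CategoryTheory.Bundled.{w} L.Structure,
      c = Quotient.mk _ N ∧ Cardinal.mk N = Cardinal.mk M ∧ InfEquiv L (Cardinal.mk M) N M}

/-! ### Ladder systems and colourings -/

/-- The set of countable ordinals, i.e. the well-ordered set `ω₁`. -/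
abbrev Omega1 : Type := (ω₁ : Ordinal.{0}).ToType

/-- The `F`-vector space freely generated by `x_ξ`, `ξ < ω₁`. -/
abbrev Vec (F : Type u) [Field F] : Type u := Omega1 →₀ F

/-- For `y = ∑ e_ξ x_ξ` the value `f(y) = ∑ e_ξ * f(ξ)`. -/
noncomputable abbrev evalVec {F : Type u} [Field F] (f : Omega1 → F) (y : Vec F) : F :=
  y.sum fun ξ e => e * f ξ

/-- `y` is a ladder on `δ` (the minimum of a finite set is taken in `ω₁` with a top element, which
is the minimum of `∅`; supports of members of a ladder are nonempty by the last clause). -/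
structure IsLadder (F : Type u) [Field F] (δ : Omega1) (y : ℕ → Vec F) : Prop where
  support_lt : ∀ n, ∀ ξ ∈ (y n).support, ξ < δ
  min_mono : Monotone fun n => (y n).support.min
  min_lim : IsLUB (Set.range fun n => (y n).support.min) (δ : WithTop Omega1)
  not_cover : ∀ n, ¬ (((y n).support : Set Omega1) ⊆ ⋃ m < n, ((y m).support : Set Omega1))

/-- A ladder system on `S`. -/
structure LadderSystem (F : Type u) [Field F] (S : Set Omega1) where
  ladder : S → ℕ → Vec F
  isLadder : ∀ δ : S, IsLadder F δ (ladder δ)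

/-- The vector space of all `F`-colourings on `S`. -/
abbrev Colouring (F : Type u) (S : Set Omega1) : Type u := S → ℕ → F

/-- `f : ω₁ → F` uniformizes the colouring `a`. -/
def Uniformizes {F : Type u} [Field F] {S : Set Omega1} (η : LadderSystem F S) (D : Filter ℕ)
    (f : Omega1 → F) (a : Colouring F S) : Prop :=
  ∀ δ : S, {n | evalVec f (η.ladder δ n) = a δ n} ∈ D

/-- The subspace of uniform colourings. -/
def Unif {F : Type u} [Field F] {S : Set Omega1} (η : LadderSystem F S) (D : Filter ℕ) :
    Submodule F (Colouring F S) where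
  carrier := {a | ∃ f : Omega1 → F, Uniformizes η D f a}
  zero_mem' := by
    refine ⟨0, fun δ => Filter.mem_of_superset Filter.univ_mem fun n _ => ?_⟩
    change evalVec 0 (η.ladder δ n) = 0
    exact Finset.sum_eq_zero fun ξ _ => mul_zero _
  add_mem' := by
    rintro a b ⟨f, hf⟩ ⟨g, hg⟩
    refine ⟨f + g, fun δ => ?_⟩
    filter_upwards [hf δ, hg δ] with n h1 h2
    change evalVec f (η.ladder δ n) = a δ n at h1
    change evalVec g (η.ladder δ n) = b δ n at h2
    change evalVec (f + g) (η.ladder δ n) = a δ n + b δ n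
    simp [← h1, ← h2, mul_add, Finsupp.sum, Finset.sum_add_distrib]
  smul_mem' := by
    rintro c a ⟨f, hf⟩
    refine ⟨c • f, fun δ => ?_⟩
    filter_upwards [hf δ] with n h1
    change evalVec f (η.ladder δ n) = a δ n at h1
    change evalVec (c • f) (η.ladder δ n) = c * a δ n
    simp [← h1, Finsupp.sum, Finset.mul_sum, mul_left_comm]

/-- Two colourings are equivalent if their difference is uniform. -/
def ColEquiv {F : Type u} [Field F] {S : Set Omega1} (η : LadderSystem F S) (D : Filter ℕ)
    (a b : Colouring F S) : Prop :=
  a - b ∈ Unif η D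

/-! ### The coded models -/

/-- The functions `u : ω → F` that vanish on a set in `D`. -/
def NullSeq (F : Type u) [Field F] (D : Filter ℕ) : Submodule F (ℕ → F) where
  carrier := {s | {n | s n = 0} ∈ D}
  zero_mem' := by simp
  add_mem' := by
    intro a b ha hb
    filter_upwards [ha, hb] with n h1 h2
    change a n = 0 at h1
    change b n = 0 at h2
    change a n + b n = 0
    simp [h1, h2]
  smul_mem' := by
    intro c a ha
    filter_upwards [ha] with n h1
    change a n = 0 at h1
    change c * a n = 0
    simp [h1]

/-- The relation symbols of the vocabulary. -/
inductive VocRel (F : Type u) [Field F] (S : Set Omega1) (D : Filter ℕ) : ℕ → Type u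
  /-- the unary symbol `R_y` -/
  | vec (y : Vec F) : VocRel F S D 1
  /-- the unary symbol `R_δ` -/
  | ord (δ : S) : VocRel F S D 1
  /-- the binary symbol `Pr_n` (a partial function) -/
  | pr (n : ℕ) : VocRel F S D 2
  /-- the binary symbol `+_b` (a partial function) -/
  | addScalar (b : F) : VocRel F S D 2
  /-- the binary symbol `+_s` (a partial function) -/
  | addSeq (s : NullSeq F D) : VocRel F S D 2
  /-- the ternary symbol `+` (a partial binary function) -/
  | add : VocRel F S D 3
  /-- the binary symbol `·_e` (a partial function) -/
  | smul (e : F) : VocRel F S D 2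

/-- The (purely relational) vocabulary of the coded models. -/
def Voc (F : Type u) [Field F] (S : Set Omega1) (D : Filter ℕ) : FirstOrder.Language.{0, u} where
  Functions := fun _ => Empty
  Relations := VocRel F S D

/-- The domain `(S × NullSeq) ∪ (Vec × F)` of the model coding the colouring `a`. -/
def CodedModel {F : Type u} [Field F] {S : Set Omega1} (_η : LadderSystem F S) (D : Filter ℕ)
    (_a : Colouring F S) : Type u :=
  (S × NullSeq F D) ⊕ (Vec F × F)

/-- The interpretation of the relation symbols in the model coding `a`. -/
def codedRel {F : Type u} [Field F] {S : Set Omega1} (η : LadderSystem F S) (D : Filter ℕ)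
    (a : Colouring F S) :
    {n : ℕ} → VocRel F S D n → (Fin n → (S × NullSeq F D) ⊕ (Vec F × F)) → Prop
  | _, .vec y, p => ∃ c : F, p 0 = .inr (y, c)
  | _, .ord δ, p => ∃ s : NullSeq F D, p 0 = .inl (δ, s)
  | _, .pr n, p => ∃ (δ : S) (s : NullSeq F D),
      p 0 = .inl (δ, s) ∧ p 1 = .inr (η.ladder δ n, a δ n + s.1 n)
  | _, .addScalar b, p => ∃ (y : Vec F) (c : F), p 0 = .inr (y, c) ∧ p 1 = .inr (y, c + b)
  | _, .addSeq s, p => ∃ (δ : S) (t : NullSeq F D), p 0 = .inl (δ, t) ∧ p 1 = .inl (δ, t + s)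
  | _, .add, p => ∃ (y z : Vec F) (b c : F),
      p 0 = .inr (y, b) ∧ p 1 = .inr (z, c) ∧ p 2 = .inr (y + z, b + c)
  | _, .smul e, p => ∃ (y : Vec F) (b : F), p 0 = .inr (y, b) ∧ p 1 = .inr (e • y, e * b)

/-- The model coding the colouring `a`. -/
instance codedStructure {F : Type u} [Field F] {S : Set Omega1} (η : LadderSystem F S)
    (D : Filter ℕ) (a : Colouring F S) : (Voc F S D).Structure (CodedModel η D a) where
  funMap := fun f => nomatch f
  RelMap := fun R => codedRel η D a R

end LadderModels

open LadderModels

/-! All the models `CodedModel η D a` have the same domain, and only the relations `pr n` depend on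
`a`. A bijection from the model of `a` to that of `b` that respects the other relations must
translate each fibre: the fibre over a vector y by g(y), where g is a linear functional, and the
fibre over δ by some null sequence w(δ). It respects `pr n` as well iff g(y_{δ,n}) - w(δ)(n) =
b(δ,n) - a(δ,n) for all δ. As w(δ) vanishes on a set in D, such g and w exist iff b - a is uniform.
This is (i): `codedRel_shift` for one direction, `colEquiv_of_equiv` for the other.

Below any countable ordinal every colouring can be uniformized, and a function that does so up to β
can be changed above β so as to work up to α (`LadderSystem.exists_extend`): countably many ladders
have disjoint tails, and a single ladder is linearly independent, so values on it are free. The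
resulting shifts, restricted to bounded parts of the models, form a back-and-forth system for
countable blocks, whence all coded models are equivalent in the logic for ℵ₁ (`realize_shift`).

For (ii), let N be equivalent to a coded model. Back and forth makes each countable subset of N look
like a subset of that model (`InfEquiv.exists_isChart`). Hence the part of N over vectors is a
vector space mapping linearly onto `Vec F`, and a linear section of this map chooses origins in the
fibres compatibly with the operations. Together with arbitrary origins in the fibres over S it gives
coordinates on N; the values of the projections in these coordinates form a colouring b, and N is
the model of b (`IsFrame`). Finally (iii) follows from (i), (ii) and the equivalence of all coded
models. -/

namespace LadderModels

/-! ### Countable ordinals -/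

/-- A countable set of countable ordinals is bounded. -/
theorem Omega1.bddAbove_of_countable {s : Set Omega1} (hs : s.Countable) : BddAbove s := by
  have := hs.to_subtype
  have hlt := Ordinal.iSup_lt_omega_one (f := fun i : s => ((i : Omega1).toOrd : Ordinal))
    fun i => (i : Omega1).toOrd.2
  refine ⟨Ordinal.ToType.mk ⟨_, hlt⟩, fun i hi => ?_⟩
  rw [← OrderIso.symm_apply_le]
  exact Ordinal.le_iSup (fun i : s => ((i : Omega1).toOrd : Ordinal)) ⟨i, hi⟩

theorem Omega1.countable_Iio (a : Omega1) : (Set.Iio a).Countable := by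
  rw [← Cardinal.le_aleph0_iff_set_countable]
  have h := Ordinal.typein_lt_self a
  rw [Cardinal.lt_omega_iff_card_lt, Ordinal.card_typein, ← Cardinal.succ_aleph0,
    Order.lt_succ_iff] at h
  exact h

theorem Omega1.countable_Iic (a : Omega1) : (Set.Iic a).Countable := by
  rw [← Set.Iio_insert]
  exact (Omega1.countable_Iio a).insert a

/-! ### Evaluation of functions at vectors -/

section Eval

variable {F : Type u} [Field F]

theorem evalVec_eq_linearCombination (f : Omega1 → F) (y : Vec F) :
    evalVec f y = Finsupp.linearCombination F f y := rfl

theorem evalVec_add (f : Omega1 → F) (y z : Vec F) :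
    evalVec f (y + z) = evalVec f y + evalVec f z := by
  simp only [evalVec_eq_linearCombination, map_add]

theorem evalVec_smul (f : Omega1 → F) (e : F) (y : Vec F) :
    evalVec f (e • y) = e * evalVec f y := by
  simp only [evalVec_eq_linearCombination, map_smul, smul_eq_mul]

theorem evalVec_congr {f g : Omega1 → F} {y : Vec F} (h : ∀ ξ ∈ y.support, f ξ = g ξ) :
    evalVec f y = evalVec g y :=
  Finset.sum_congr rfl fun ξ hξ => by simp only [h ξ hξ]

theorem evalVec_neg_left (f : Omega1 → F) (y : Vec F) : evalVec (-f) y = -evalVec f y := by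
  simp [evalVec, Finsupp.sum]

/-- A linear functional is evaluation at its values on the basis. -/
theorem evalVec_linearMap (φ : Vec F →ₗ[F] F) (y : Vec F) :
    evalVec (fun ξ => φ (Finsupp.single ξ 1)) y = φ y := by
  rw [evalVec_eq_linearCombination]
  have : Finsupp.linearCombination F (fun ξ => φ (Finsupp.single ξ 1)) = φ := by
    ext ξ
    simp
  rw [this]

end Eval

/-! ### Ladders: independence, disjoint tails, extension of partial uniformizations -/

section Ladder

variable {F : Type u} [Field F]

/-- In a nontrivial relation let n be the largest index that occurs. Some basis vector appears in y
n but in no earlier member, so at that coordinate only the n-th term contributes. -/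
theorem linearIndependent_of_not_cover {y : ℕ → Vec F}
    (h : ∀ n, ¬ (((y n).support : Set Omega1) ⊆ ⋃ m < n, ((y m).support : Set Omega1))) :
    LinearIndependent F y := by
  rw [linearIndependent_iff]
  intro l hl
  by_contra hne
  have hs : l.support.Nonempty := Finsupp.support_nonempty_iff.2 hne
  set n := l.support.max' hs
  have hn : l n ≠ 0 := Finsupp.mem_support_iff.1 (l.support.max'_mem hs)
  obtain ⟨ξ, hξ, hξ'⟩ := Set.not_subset.1 (h n)
  have h0 := DFunLike.congr_fun hl ξ
  rw [Finsupp.linearCombination_apply, Finsupp.sum, Finsupp.finsetSum_apply,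
    Finset.sum_eq_single n] at h0
  · simp only [Finsupp.smul_apply, smul_eq_mul, Finsupp.coe_zero, Pi.zero_apply,
      mul_eq_zero, hn, false_or] at h0
    exact Finsupp.mem_support_iff.1 hξ h0
  · intro m hm hmn
    have hlt : m < n := lt_of_le_of_ne (l.support.le_max' m hm) hmn
    have : y m ξ = 0 := by
      by_contra hne'
      exact hξ' (Set.mem_iUnion₂.2 ⟨m, hlt, Finsupp.mem_support_iff.2 hne'⟩)
    simp [this]
  · intro hn'
    exact absurd (l.support.max'_mem hs) hn'

/-- The values of a function can be prescribed on a ladder. -/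
theorem IsLadder.exists_evalVec_eq {δ : Omega1} {y : ℕ → Vec F} (h : IsLadder F δ y)
    (c : ℕ → F) : ∃ f : Omega1 → F, ∀ n, evalVec f (y n) = c n := by
  have hli := linearIndependent_of_not_cover h.not_cover
  -- The prescribed values define a functional on the span of the ladder, which extends to all of
  -- `Vec F`.
  obtain ⟨φ, hφ⟩ := LinearMap.exists_extend ((Module.Basis.span hli).constr F c)
  refine ⟨fun ξ => φ (Finsupp.single ξ 1), fun n => ?_⟩
  rw [evalVec_linearMap]
  have h1 := LinearMap.congr_fun hφ (Module.Basis.span hli n)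
  rw [Module.Basis.constr_basis, LinearMap.comp_apply, Submodule.subtype_apply,
    Module.Basis.span_apply] at h1
  exact h1

theorem IsLadder.eventually_lt {δ γ : Omega1} {y : ℕ → Vec F} (h : IsLadder F δ y) (hγ : γ < δ) :
    ∀ᶠ n in Filter.atTop, ∀ ξ ∈ (y n).support, γ < ξ := by
  have h1 : (γ : WithTop Omega1) < δ := WithTop.coe_lt_coe.2 hγ
  obtain ⟨_, ⟨n, rfl⟩, hn⟩ := (lt_isLUB_iff h.min_lim).1 h1
  filter_upwards [Filter.eventually_ge_atTop n] with m hm ξ hξ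
  exact WithTop.coe_lt_coe.1 (hn.trans_le ((h.min_mono hm).trans (Finset.min_le hξ)))

/-- The tail of a ladder on `δ'` avoids a ladder on another ordinal. -/
theorem IsLadder.eventually_disjoint {δ δ' : Omega1} {y y' : ℕ → Vec F} (h : IsLadder F δ y)
    (h' : IsLadder F δ' y') (hne : δ ≠ δ') :
    ∀ᶠ m in Filter.atTop, ∀ n, Disjoint (y n).support (y' m).support := by
  rcases lt_or_gt_of_ne hne with hlt | hlt
  · filter_upwards [h'.eventually_lt hlt] with m hm n
    exact Finset.disjoint_left.2 fun ξ h1 h2 => (h.support_lt n ξ h1).asymm (hm ξ h2)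
  -- Here δ' < δ, so all but finitely many members of y lie above δ'. The remaining ones have
  -- finitely many support elements below δ', and a tail of y' lies above all of these.
  · obtain ⟨n₀, hn₀⟩ := Filter.eventually_atTop.1 (h.eventually_lt hlt)
    have key : ∀ᶠ m in Filter.atTop, ∀ n ∈ Finset.range n₀, ∀ γ ∈ (y n).support,
        γ < δ' → ∀ ξ ∈ (y' m).support, γ < ξ := by
      simp only [Filter.eventually_all_finset]
      intro n _ γ _
      by_cases hγ : γ < δ'
      · filter_upwards [h'.eventually_lt hγ] with m hm _ using hm
      · exact Filter.Eventually.of_forall fun m hm => absurd hm hγ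
    filter_upwards [key] with m hm n
    refine Finset.disjoint_left.2 fun ξ h1 h2 => ?_
    have hξ := h'.support_lt m ξ h2
    by_cases hn : n < n₀
    · exact lt_irrefl _ (hm n (Finset.mem_range.2 hn) ξ h1 hξ ξ h2)
    · exact hξ.asymm (hn₀ n (not_lt.1 hn) ξ h1)

/-- Countably many ladders have tails with pairwise disjoint supports above a given bound. -/
theorem LadderSystem.exists_disjoint_tails {S : Set Omega1} (η : LadderSystem F S) (β : Omega1)
    {T : Set S} (hT : T.Countable) (hβ : ∀ δ ∈ T, β < (δ : Omega1)) :
    ∃ N : S → ℕ, (∀ δ ∈ T, ∀ n ≥ N δ, ∀ ξ ∈ (η.ladder δ n).support, β < ξ) ∧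
      ∀ δ ∈ T, ∀ δ' ∈ T, ∀ n ≥ N δ, ∀ m ≥ N δ', ∀ ξ,
        ξ ∈ (η.ladder δ n).support → ξ ∈ (η.ladder δ' m).support → δ = δ' := by
  obtain ⟨e, he⟩ := Set.countable_iff_exists_injOn.1 hT
  have key : ∀ δ' : S, ∃ N, δ' ∈ T → ∀ m ≥ N,
      (∀ ξ ∈ (η.ladder δ' m).support, β < ξ) ∧
        ∀ δ ∈ T, e δ < e δ' → ∀ n, Disjoint (η.ladder δ n).support (η.ladder δ' m).support := by
    intro δ'
    by_cases hδ' : δ' ∈ T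
    -- In an enumeration of T each ladder has only finitely many predecessors, so one tail of it
    -- avoids them all.
    · have hfin : {δ ∈ T | e δ < e δ'}.Finite := by
        refine Set.Finite.of_finite_image (f := e) ?_ (he.mono fun δ h => h.1)
        refine (Set.finite_lt_nat (e δ')).subset ?_
        rintro _ ⟨δ, h, rfl⟩
        exact h.2
      have h2 : ∀ᶠ m in Filter.atTop, ∀ δ ∈ {δ ∈ T | e δ < e δ'}, ∀ n,
          Disjoint (η.ladder δ n).support (η.ladder δ' m).support := by
        rw [Filter.eventually_all_finite hfin]
        rintro δ ⟨_, hlt⟩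
        exact (η.isLadder δ).eventually_disjoint (η.isLadder δ')
          fun h => hlt.ne (by rw [Subtype.ext h])
      obtain ⟨N, hN⟩ := Filter.eventually_atTop.1
        (((η.isLadder δ').eventually_lt (hβ δ' hδ')).and h2)
      exact ⟨N, fun _ m hm => ⟨(hN m hm).1, fun δ hδ hlt => (hN m hm).2 δ ⟨hδ, hlt⟩⟩⟩
    · exact ⟨0, fun h => absurd h hδ'⟩
  choose N hN using key
  refine ⟨N, fun δ hδ n hn => (hN δ hδ n hn).1, fun δ hδ δ' hδ' n hn m hm ξ h1 h2 => ?_⟩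
  by_contra hne
  rcases lt_or_gt_of_ne (fun h => hne (he hδ hδ' h)) with hlt | hlt
  · exact Finset.disjoint_left.1 ((hN δ' hδ' m hm).2 δ hδ hlt n) h1 h2
  · exact Finset.disjoint_left.1 ((hN δ hδ n hn).2 δ' hδ' hlt m) h2 h1

/-- A function can be changed above `β` so as to uniformize a colouring on the interval
`(β, α]`. -/
theorem LadderSystem.exists_extend {S : Set Omega1} (η : LadderSystem F S) {D : Filter ℕ}
    (hD : ∀ I : Set ℕ, Iᶜ.Finite → I ∈ D) (d : Colouring F S) (f : Omega1 → F) (β α : Omega1) :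
    ∃ g : Omega1 → F, (∀ ξ ≤ β, g ξ = f ξ) ∧
      ∀ δ : S, β < (δ : Omega1) → (δ : Omega1) ≤ α →
        {n | evalVec g (η.ladder δ n) = d δ n} ∈ D := by
  classical
  let T : Set S := {δ | β < (δ : Omega1) ∧ (δ : Omega1) ≤ α}
  have hT : T.Countable :=
    Set.Countable.preimage_of_injOn
      ((Omega1.countable_Iic α).mono (Set.inter_subset_right (s := Set.Ioi β)))
      Subtype.val_injective.injOn
  obtain ⟨N, hN, hdisj⟩ := η.exists_disjoint_tails β hT fun δ hδ => hδ.1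
  choose φ hφ using fun δ : S => (η.isLadder δ).exists_evalVec_eq (d δ)
  let P : Omega1 → S → Prop := fun ξ δ => δ ∈ T ∧ ∃ n ≥ N δ, ξ ∈ (η.ladder δ n).support
  -- The tails are disjoint, so at most one δ claims a given ξ, and on the tail from N δ on g agrees
  -- with the solution `φ δ`. Only the finitely many n < N δ are given up, which `hD` permits.
  let g : Omega1 → F := fun ξ => if h : ∃ δ, P ξ δ then φ h.choose ξ else f ξ
  refine ⟨g, fun ξ hξ => ?_, fun δ h1 h2 => hD _ ?_⟩
  · refine dif_neg ?_
    rintro ⟨δ, hδ, n, hn, hmem⟩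
    exact (hN δ hδ n hn ξ hmem).not_ge hξ
  · refine (Set.finite_lt_nat (N δ)).subset fun n hn => ?_
    by_contra hlt
    have hge : N δ ≤ n := not_lt.1 hlt
    refine hn ?_
    change evalVec g (η.ladder δ n) = d δ n
    rw [← hφ δ n]
    refine evalVec_congr fun ξ hξ => ?_
    have hP : ∃ δ, P ξ δ := ⟨δ, ⟨h1, h2⟩, n, hge, hξ⟩
    obtain ⟨hT', m, hm, hmem⟩ := hP.choose_spec
    have : hP.choose = δ := hdisj _ hT' δ ⟨h1, h2⟩ m hm n hge ξ hmem hξ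
    change (if h : ∃ δ, P ξ δ then φ h.choose ξ else f ξ) = _
    rw [dif_pos hP, this]

end Ladder

/-! ### Translations between coded models -/

section Shift

variable {F : Type u} [Field F] {S : Set Omega1} (η : LadderSystem F S) (D : Filter ℕ)

/-- The error made by `f` in uniformizing `d` at `δ`, or `0` if `f` does not uniformize `d`
at `δ`. -/
noncomputable def defect (d : Colouring F S) (f : Omega1 → F) (δ : S) : NullSeq F D :=
  open Classical in
  if h : {n | evalVec f (η.ladder δ n) = d δ n} ∈ D then
    ⟨fun n => evalVec f (η.ladder δ n) - d δ n,
      Filter.mem_of_superset h fun _ hn => sub_eq_zero.2 hn⟩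
  else 0

variable {η D}

theorem defect_apply {d : Colouring F S} {f : Omega1 → F} {δ : S}
    (h : {n | evalVec f (η.ladder δ n) = d δ n} ∈ D) (n : ℕ) :
    (defect η D d f δ).1 n = evalVec f (η.ladder δ n) - d δ n := by
  rw [defect, dif_pos h]

theorem defect_congr {d : Colouring F S} {f g : Omega1 → F} {δ : S}
    (h : ∀ n, evalVec f (η.ladder δ n) = evalVec g (η.ladder δ n)) :
    defect η D d f δ = defect η D d g δ := by
  by_cases hf : {n | evalVec f (η.ladder δ n) = d δ n} ∈ D
  · have hg : {n | evalVec g (η.ladder δ n) = d δ n} ∈ D := by simpa only [h] using hf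
    exact Subtype.ext (funext fun n => by rw [defect_apply hf, defect_apply hg, h])
  · have hg : {n | evalVec g (η.ladder δ n) = d δ n} ∉ D := by simpa only [h] using hf
    rw [defect, dif_neg hf, defect, dif_neg hg]

variable (η D)

/-- The permutation of the common domain of the coded models that translates the fibres over
vectors by the values of `f` and the fibres over `S` by the defect. -/
@[simps]
noncomputable def shift (d : Colouring F S) (f : Omega1 → F) :
    (S × NullSeq F D) ⊕ (Vec F × F) ≃ (S × NullSeq F D) ⊕ (Vec F × F) where
  toFun := Sum.map (fun p => (p.1, p.2 + defect η D d f p.1)) fun p => (p.1, p.2 + evalVec f p.1)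
  invFun := Sum.map (fun p => (p.1, p.2 - defect η D d f p.1)) fun p => (p.1, p.2 - evalVec f p.1)
  left_inv := by rintro (p | p) <;> simp
  right_inv := by rintro (p | p) <;> simp

variable {η D}

section CodedRel

variable {a : Colouring F S} {k : ℕ} {δ δ' : S} {s s' : NullSeq F D} {y z w : Vec F} {b c d : F}

theorem codedRel_pr {p : Fin 2 → (S × NullSeq F D) ⊕ (Vec F × F)} {n : ℕ}
    (h0 : p 0 = .inl (δ, s)) (h1 : p 1 = .inr (y, c)) :
    codedRel η D a (.pr n) p ↔ y = η.ladder δ n ∧ c = a δ n + s.1 n := by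
  simp [codedRel, h0, h1]

theorem codedRel_addScalar {p : Fin 2 → (S × NullSeq F D) ⊕ (Vec F × F)} {e : F}
    (h0 : p 0 = .inr (y, b)) (h1 : p 1 = .inr (z, c)) :
    codedRel η D a (.addScalar e) p ↔ z = y ∧ c = b + e := by
  simp [codedRel, h0, h1]

theorem codedRel_addSeq {p : Fin 2 → (S × NullSeq F D) ⊕ (Vec F × F)} {t : NullSeq F D}
    (h0 : p 0 = .inl (δ, s)) (h1 : p 1 = .inl (δ', s')) :
    codedRel η D a (.addSeq t) p ↔ δ' = δ ∧ s' = s + t := by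
  simp only [codedRel, h0, h1, Sum.inl.injEq, Prod.mk.injEq]
  constructor
  · rintro ⟨_, _, ⟨rfl, rfl⟩, h⟩
    exact h
  · rintro ⟨rfl, rfl⟩
    exact ⟨_, _, ⟨rfl, rfl⟩, rfl, rfl⟩

theorem codedRel_add {p : Fin 3 → (S × NullSeq F D) ⊕ (Vec F × F)}
    (h0 : p 0 = .inr (y, b)) (h1 : p 1 = .inr (z, c)) (h2 : p 2 = .inr (w, d)) :
    codedRel η D a .add p ↔ w = y + z ∧ d = b + c := by
  simp [codedRel, h0, h1, h2]

theorem codedRel_smul {p : Fin 2 → (S × NullSeq F D) ⊕ (Vec F × F)} {e : F}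
    (h0 : p 0 = .inr (y, b)) (h1 : p 1 = .inr (z, c)) :
    codedRel η D a (.smul e) p ↔ z = e • y ∧ c = e * b := by
  simp [codedRel, h0, h1]

theorem codedRel_ord {p : Fin 1 → (S × NullSeq F D) ⊕ (Vec F × F)} :
    codedRel η D a (.ord δ) p ↔ ∃ s, p 0 = .inl (δ, s) := Iff.rfl

end CodedRel

theorem shift_inl (d : Colouring F S) (f : Omega1 → F) (δ : S) (s : NullSeq F D) :
    shift η D d f (.inl (δ, s)) = .inl (δ, s + defect η D d f δ) := rfl

theorem shift_inr (d : Colouring F S) (f : Omega1 → F) (y : Vec F) (c : F) :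
    shift η D d f (.inr (y, c)) = .inr (y, c + evalVec f y) := rfl

/-- Linearity of evaluation takes care of `add` and `smul`; for `pr` the defect cancels the
difference between b and a. Uniformization is required only at those δ that occur in the tuple, so
that the lemma also serves functions that uniformize only up to some ordinal. -/
theorem codedRel_shift {a b : Colouring F S} {f : Omega1 → F} {k : ℕ} (R : VocRel F S D k)
    (p : Fin k → (S × NullSeq F D) ⊕ (Vec F × F))
    (hp : ∀ i δ s, p i = .inl (δ, s) → {n | evalVec f (η.ladder δ n) = (b - a) δ n} ∈ D) :
    codedRel η D b R (fun i => shift η D (b - a) f (p i)) ↔ codedRel η D a R p := by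
  cases R with
  | vec y => rcases h0 : p 0 with ⟨δ, s⟩ | ⟨z, c⟩ <;> simp [codedRel, h0]
  | ord δ =>
    rcases h0 : p 0 with ⟨δ', s⟩ | ⟨z, c⟩
    · rw [codedRel_ord, codedRel_ord, h0, shift_inl]
      constructor <;> rintro ⟨_, h⟩ <;> cases h <;> exact ⟨_, rfl⟩
    · simp [codedRel, h0]
  | pr n =>
    rcases h0 : p 0 with ⟨δ, s⟩ | ⟨y, c⟩ <;> rcases h1 : p 1 with ⟨δ', s'⟩ | ⟨z, c'⟩ <;>
      try simp [codedRel, h0, h1]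
    rw [defect_apply (hp 0 δ s h0)]
    rintro rfl
    rw [Pi.sub_apply, Pi.sub_apply]
    constructor <;> intro h <;> linear_combination h
  | addScalar e =>
    rcases h0 : p 0 with ⟨δ, s⟩ | ⟨y, c⟩ <;> rcases h1 : p 1 with ⟨δ', s'⟩ | ⟨z, c'⟩ <;>
      try simp [codedRel, h0, h1]
    rintro rfl
    constructor <;> intro h <;> linear_combination h
  | addSeq t =>
    rcases h0 : p 0 with ⟨δ, s⟩ | ⟨y, c⟩ <;> rcases h1 : p 1 with ⟨δ', s'⟩ | ⟨z, c'⟩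
    · rw [codedRel_addSeq h0 h1, codedRel_addSeq ((congrArg _ h0).trans (shift_inl ..))
        ((congrArg _ h1).trans (shift_inl ..))]
      refine and_congr_right ?_
      rintro rfl
      rw [add_right_comm, add_left_inj]
    all_goals simp [codedRel, h0, h1]
  | add =>
    rcases h0 : p 0 with ⟨δ, s⟩ | ⟨y, c⟩ <;> rcases h1 : p 1 with ⟨δ', s'⟩ | ⟨z, c'⟩ <;>
      rcases h2 : p 2 with ⟨δ'', s''⟩ | ⟨w, c''⟩ <;> try simp [codedRel, h0, h1, h2]
    rintro rfl
    rw [evalVec_add]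
    constructor <;> intro h <;> linear_combination h
  | smul e =>
    rcases h0 : p 0 with ⟨δ, s⟩ | ⟨y, c⟩ <;> rcases h1 : p 1 with ⟨δ', s'⟩ | ⟨z, c'⟩ <;>
      try simp [codedRel, h0, h1]
    rintro rfl
    rw [evalVec_smul]
    constructor <;> intro h <;> linear_combination h

end Shift

/-! ### Isomorphism of coded models and equivalence of colourings -/

section Isomorphism

variable {F : Type u} [Field F] {S : Set Omega1} {η : LadderSystem F S} {D : Filter ℕ}

theorem nonempty_equiv_of_colEquiv {a b : Colouring F S} (h : ColEquiv η D a b) :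
    Nonempty (CodedModel η D a ≃[Voc F S D] CodedModel η D b) := by
  have h' : b - a ∈ Unif η D := by
    rw [← neg_sub]
    exact (Unif η D).neg_mem h
  obtain ⟨f, hf⟩ := h'
  exact ⟨{ toEquiv := shift η D (b - a) f
           map_fun' := fun g => nomatch g
           map_rel' := fun R p => codedRel_shift R p fun _ δ _ _ => hf δ }⟩

/-- The unary relations force φ to preserve fibres and `addScalar` forces it to act on vector fibres
by translations. The translation amounts g are linear because of `add` and `smul`, and `pr` compares
them with the null sequences t δ by which the origins over S move. -/
theorem colEquiv_of_equiv {a b : Colouring F S}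
    (φ : CodedModel η D a ≃[Voc F S D] CodedModel η D b) : ColEquiv η D a b := by
  have hrel : ∀ {k : ℕ} (R : VocRel F S D k) (p : Fin k → (S × NullSeq F D) ⊕ (Vec F × F)),
      codedRel η D b R (fun i => φ (p i)) ↔ codedRel η D a R p :=
    fun R p => φ.map_rel R p
  have hV : ∀ y : Vec F, ∃ c, φ (.inr (y, 0)) = .inr (y, c) := fun y =>
    (hrel (.vec y) ![.inr (y, 0)]).2 ⟨0, rfl⟩
  have hS : ∀ δ : S, ∃ s, φ (.inl (δ, 0)) = .inl (δ, s) := fun δ =>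
    (hrel (.ord δ) ![.inl (δ, 0)]).2 ⟨0, rfl⟩
  choose g hg using hV
  choose t ht using hS
  have hφ : ∀ y c, φ (.inr (y, c)) = .inr (y, g y + c) := by
    intro y c
    obtain ⟨c', hc'⟩ := (hrel (.vec y) ![.inr (y, c)]).2 ⟨c, rfl⟩
    have h := (hrel (.addScalar c) ![.inr (y, 0), .inr (y, c)]).2
      ((codedRel_addScalar rfl rfl).2 ⟨rfl, (zero_add c).symm⟩)
    have h2 := ((codedRel_addScalar (hg y) hc').1 h).2
    exact hc'.trans (by rw [h2])
  let G : Vec F →ₗ[F] F :=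
    { toFun := g
      map_add' := fun y z =>
        ((codedRel_add (hg y) (hg z) (hg (y + z))).1
          ((hrel .add ![.inr (y, 0), .inr (z, 0), .inr (y + z, 0)]).2
            ((codedRel_add rfl rfl rfl).2 ⟨rfl, (add_zero 0).symm⟩))).2
      map_smul' := fun e y =>
        ((codedRel_smul (hg y) (hg (e • y))).1
          ((hrel (.smul e) ![.inr (y, 0), .inr (e • y, 0)]).2
            ((codedRel_smul rfl rfl).2 ⟨rfl, (mul_zero e).symm⟩))).2 }
  -- The projections give g(y_{δ,n}) + a δ n = b δ n wherever t δ vanishes, so it is -g that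
  -- uniformizes a - b.
  refine ⟨-fun ξ => G (Finsupp.single ξ 1), fun δ => Filter.mem_of_superset (t δ).2 fun n hn => ?_⟩
  have hn' : (t δ).1 n = 0 := hn
  change evalVec (-fun ξ => G (Finsupp.single ξ 1)) _ = a δ n - b δ n
  rw [evalVec_neg_left, evalVec_linearMap]
  have h := (hrel (.pr n) ![.inl (δ, 0), .inr (η.ladder δ n, a δ n)]).2
      ((codedRel_pr rfl rfl).2 ⟨rfl, (add_zero _).symm⟩)
  have h2 := ((codedRel_pr (ht δ) (hφ _ _)).1 h).2
  rw [hn', add_zero] at h2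
  change -g _ = _
  rw [← h2]
  ring

end Isomorphism

/-! ### Equivalence of all coded models in infinitary logic -/

section InfEquivCoded

variable {F : Type u} [Field F] {S : Set Omega1} {η : LadderSystem F S} {D : Filter ℕ}

theorem realize_term_comp {M N : Type x} [(Voc F S D).Structure M] [(Voc F S D).Structure N]
    {α : Type w} (t : (Voc F S D).Term α) (σ : M → N) (e : α → M) :
    t.realize (fun i => σ (e i)) = σ (t.realize e) := by
  cases t with
  | var i => rfl
  | func f _ => exact nomatch f

/-- An element of a coded model is below `β` if it lies over a vector with support in `[0, β]`
or over an element of `S ∩ [0, β]`. -/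
def Below (β : Omega1) : (S × NullSeq F D) ⊕ (Vec F × F) → Prop
  | .inl p => (p.1 : Omega1) ≤ β
  | .inr p => ∀ ξ ∈ p.1.support, ξ ≤ β

theorem Below.mono {α β : Omega1} (h : α ≤ β) {m : (S × NullSeq F D) ⊕ (Vec F × F)}
    (hm : Below α m) : Below β m := by
  rcases m with p | p
  · exact le_trans (α := Omega1) hm h
  · exact fun ξ hξ => (hm ξ hξ).trans h

theorem below_symm_shift {d : Colouring F S} {f : Omega1 → F} {β : Omega1}
    {m : (S × NullSeq F D) ⊕ (Vec F × F)} :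
    Below β ((shift η D d f).symm m) ↔ Below β m := by
  rcases m with p | p <;> rfl

theorem exists_below (β : Omega1) {ι : Type w} [Countable ι]
    (e : ι → (S × NullSeq F D) ⊕ (Vec F × F)) : ∃ α, β ≤ α ∧ ∀ i, Below α (e i) := by
  have h1 : ∀ m : (S × NullSeq F D) ⊕ (Vec F × F), ∃ α, Below α m := by
    rintro (⟨δ, s⟩ | ⟨y, c⟩)
    · exact ⟨δ, le_rfl⟩
    · obtain ⟨α, hα⟩ := Omega1.bddAbove_of_countable y.support.countable_toSet
      exact ⟨α, fun ξ hξ => hα hξ⟩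
  choose B hB using h1
  obtain ⟨α, hα⟩ := Omega1.bddAbove_of_countable
    ((Set.countable_range fun i => B (e i)).insert β)
  exact ⟨α, hα (Set.mem_insert _ _), fun i =>
    (hB (e i)).mono (hα (Set.mem_insert_of_mem _ ⟨i, rfl⟩))⟩

/-- A shift does not depend on what happens above the elements in question. -/
theorem shift_congr {d : Colouring F S} {f g : Omega1 → F} {β : Omega1}
    (h : ∀ ξ ≤ β, g ξ = f ξ) {m : (S × NullSeq F D) ⊕ (Vec F × F)} (hm : Below β m) :
    shift η D d g m = shift η D d f m := by
  rcases m with ⟨δ, s⟩ | ⟨y, c⟩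
  · rw [shift_inl, shift_inl, defect_congr fun n => evalVec_congr fun ξ hξ =>
      h ξ (((η.isLadder δ).support_lt n ξ hξ).le.trans hm)]
  · rw [shift_inr, shift_inr, evalVec_congr fun ξ hξ => h ξ (hm ξ hξ)]

/-- Induction on formulas, with β and f varying. A quantified block is countable, hence lies below
some α ≥ β; f is replaced by a function that agrees with it up to β and uniformizes up to α, and the
induction hypothesis applies to that function. -/
theorem realize_shift (hD : ∀ I : Set ℕ, Iᶜ.Finite → I ∈ D) {a b : Colouring F S} {α : Type u}
    (φ : InfFormula (Voc F S D) ℵ₁ α) :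
    ∀ (β : Omega1) (f : Omega1 → F),
      (∀ δ : S, (δ : Omega1) ≤ β → {n | evalVec f (η.ladder δ n) = (b - a) δ n} ∈ D) →
      ∀ e : α → CodedModel η D a, (∀ i, Below β (e i)) →
        (φ.Realize (CodedModel η D b) (fun i => shift η D (b - a) f (e i)) ↔
          φ.Realize (CodedModel η D a) e) := by
  have term : ∀ {α : Type u} (t : (Voc F S D).Term α) (f : Omega1 → F)
      (e : α → CodedModel η D a),
      t.realize (M := CodedModel η D b) (fun i => shift η D (b - a) f (e i)) =
        shift η D (b - a) f (t.realize (M := CodedModel η D a) e) := fun t f e =>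
    realize_term_comp (M := CodedModel η D a) (N := CodedModel η D b) t
      (shift η D (b - a) f) e
  induction φ with
  | equal s t =>
    intro β f _ e _
    simp only [InfFormula.Realize, term]
    exact (shift η D (b - a) f).injective.eq_iff
  | rel R ts =>
    intro β f hf e he
    simp only [InfFormula.Realize, term]
    refine codedRel_shift R _ fun i δ s hi => hf δ ?_
    have hb : Below β ((ts i).realize (M := CodedModel η D a) e) := by
      cases ts i with
      | var j => exact he j
      | func g _ => exact nomatch g
    rw [hi] at hb
    exact hb
  | neg φ ih =>
    intro β f hf e he
    exact not_congr (ih β f hf e he)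
  | conj ι φ ih =>
    intro β f hf e he
    exact forall_congr' fun i => ih i β f hf e he
  | @all α B hB φ ih =>
    intro β f hf e he
    have : Countable B := by
      rwa [← Cardinal.mk_le_aleph0_iff, ← Order.lt_succ_iff, Cardinal.succ_aleph0]
    -- The two choices for t' serve the two directions: a block in the model of a is shifted
    -- forwards, a block in the model of b is pulled back.
    have key : ∀ t : B → (S × NullSeq F D) ⊕ (Vec F × F), ∃ g : Omega1 → F,
        ∀ t' : B → CodedModel η D a, (∀ j, t' j = t j ∨ t' j = (shift η D (b - a) g).symm (t j)) →
        (φ.Realize (CodedModel η D b)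
            (Sum.elim (fun i => shift η D (b - a) f (e i)) fun j => shift η D (b - a) g (t' j)) ↔
          φ.Realize (CodedModel η D a) (Sum.elim e t')) := by
      intro t
      obtain ⟨α, hβα, ht⟩ := exists_below β t
      obtain ⟨g, hgf, hg⟩ := η.exists_extend hD (b - a) f β α
      refine ⟨g, fun t' ht' => ?_⟩
      -- The tuple e lies below β, where g agrees with f, so both functions shift it alike.
      rw [← ih α g ?_ (Sum.elim e t') ?_]
      · refine iff_of_eq (congrArg _ (funext fun i => ?_))
        rcases i with i | i
        · exact (shift_congr hgf (he i)).symm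
        · rfl
      · intro δ hδ
        rcases le_or_gt (δ : Omega1) β with h | h
        · have : ∀ n, evalVec g (η.ladder δ n) = evalVec f (η.ladder δ n) := fun n =>
            evalVec_congr fun ξ hξ => hgf ξ (((η.isLadder δ).support_lt n ξ hξ).le.trans h)
          simpa only [this] using hf δ h
        · exact hg δ h hδ
      · rintro (i | j)
        · exact (he i).mono hβα
        · rcases ht' j with h | h <;> simp only [Sum.elim_inr, h]
          · exact ht j
          · exact below_symm_shift.2 (ht j)
    constructor
    · intro h t
      obtain ⟨g, hg⟩ := key t
      exact (hg t fun j => Or.inl rfl).1 (h _)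
    · intro h t
      obtain ⟨g, hg⟩ := key t
      have h2 := (hg (fun j => (shift η D (b - a) g).symm (t j)) fun j => Or.inr rfl).2 (h _)
      have h3 : (fun j => shift η D (b - a) g ((shift η D (b - a) g).symm (t j))) = t :=
        funext fun j => Equiv.apply_symm_apply _ _
      rw [h3] at h2
      exact h2

theorem infEquiv_codedModel (hD : ∀ I : Set ℕ, Iᶜ.Finite → I ∈ D) (a b : Colouring F S) :
    InfEquiv (Voc F S D) ℵ₁ (CodedModel η D b) (CodedModel η D a) := by
  intro φ
  have hne : Nonempty Omega1 := Ordinal.nonempty_toType_iff.2 (Ordinal.omega_pos 1).ne'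
  -- At the least ordinal there is nothing to uniformize: a ladder has a nonempty support strictly
  -- below its δ, so no element of S is ≤ β, and f = 0 will do.
  obtain ⟨β, -, hβ⟩ := (wellFounded_lt (α := Omega1)).has_min Set.univ Set.univ_nonempty
  have h := realize_shift (η := η) hD (a := a) (b := b) φ β 0 (fun δ hδ => ?_) PEmpty.elim
    fun i => i.elim
  · rw [← h]
    exact iff_of_eq (congrArg _ (funext fun i => i.elim))
  · refine absurd (fun ξ hξ => ?_) ((η.isLadder δ).not_cover 0)
    exact absurd (((η.isLadder δ).support_lt 0 ξ hξ).trans_le hδ) (hβ ξ trivial)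

end InfEquivCoded

/-! ### Back and forth and charts -/

section Charts

variable {L : FirstOrder.Language.{u, v}} {κ : Cardinal.{w}} {M N : Type w}
  [L.Structure M] [L.Structure N]

/-- Two tuples satisfy the same formulas of `L_{∞κ}`. -/
def SameType (L : FirstOrder.Language.{u, v}) (κ : Cardinal.{w}) {M N : Type w}
    [L.Structure M] [L.Structure N] {α : Type w} (e : α → N) (e' : α → M) : Prop :=
  ∀ φ : InfFormula L κ α, φ.Realize N e ↔ φ.Realize M e'

theorem SameType.symm {α : Type w} {e : α → N} {e' : α → M} (h : SameType L κ e e') :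
    SameType L κ e' e := fun φ => (h φ).symm

/-- Back and forth: tuples of the same type can be extended by short blocks. -/
theorem SameType.exists_extend {α : Type w} {e : α → N} {e' : α → M} (h : SameType L κ e e')
    {β : Type w} (hβ : Cardinal.mk β < κ) (t : β → N) :
    ∃ t' : β → M, SameType L κ (Sum.elim e t) (Sum.elim e' t') := by
  by_contra hne
  have key : ∀ t' : β → M, ∃ φ : InfFormula L κ (α ⊕ β),
      φ.Realize N (Sum.elim e t) ∧ ¬ φ.Realize M (Sum.elim e' t') := by
    intro t'
    by_contra hφ
    refine hne ⟨t', fun φ => ⟨fun h1 => ?_, fun h1 => ?_⟩⟩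
    · by_contra h2
      exact hφ ⟨φ, h1, h2⟩
    · by_contra h2
      exact hφ ⟨φ.neg, h2, fun h3 => h3 h1⟩
  choose φ hφ hφ' using key
  -- The formula says that no block satisfies all the separating formulas at once. The block t
  -- refutes it for e, while for e' it holds, since each t' fails its own formula.
  have h1 : ¬ (InfFormula.all β hβ (InfFormula.conj (β → M) φ).neg).Realize N e :=
    fun h => h t hφ
  rw [h] at h1
  exact h1 fun t' ht' => hφ' t' (ht' t')

theorem SameType.eq_iff {α : Type w} {e : α → N} {e' : α → M} (h : SameType L κ e e') (i j : α) :
    e i = e j ↔ e' i = e' j :=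
  h (.equal (.var i) (.var j))

theorem SameType.relMap_iff {α : Type w} {e : α → N} {e' : α → M} (h : SameType L κ e e') {k : ℕ}
    (R : L.Relations k) (i : Fin k → α) :
    FirstOrder.Language.Structure.RelMap R (fun j => e (i j)) ↔
      FirstOrder.Language.Structure.RelMap R (fun j => e' (i j)) :=
  h (.rel R fun j => .var (i j))

/-- A chart maps a subset of a structure injectively to another structure, so that relations
are preserved in both directions. -/
structure IsChart (L : FirstOrder.Language.{u, v}) {M N : Type w} [L.Structure M] [L.Structure N]
    (s : Set N) (m : N → M) : Prop where
  injOn : Set.InjOn m s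
  relMap_iff : ∀ {k : ℕ} (R : L.Relations k) (p : Fin k → N), (∀ i, p i ∈ s) →
    (FirstOrder.Language.Structure.RelMap R (fun i => m (p i)) ↔
      FirstOrder.Language.Structure.RelMap R p)

theorem SameType.isChart {α : Type w} {e : α → N} {e' : α → M} (h : SameType L κ e e')
    {s : Set N} {m : N → M} (hm : ∀ x ∈ s, ∃ i, e i = x ∧ e' i = m x) : IsChart L s m where
  injOn := by
    intro x hx y hy hxy
    obtain ⟨i, rfl, hi⟩ := hm x hx
    obtain ⟨j, rfl, hj⟩ := hm y hy
    rw [h.eq_iff, hi, hj, hxy]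
  relMap_iff := by
    intro k R p hp
    choose i hi hi' using fun j => hm (p j) (hp j)
    simpa only [hi, hi'] using (h.relMap_iff R i).symm

/-- Countable subsets of a structure have charts in equivalent structures, which can be extended so
as to cover a further element. -/
theorem InfEquiv.exists_isChart (h : InfEquiv L ℵ₁ N M) [Nonempty M] {s : Set N}
    (hs : s.Countable) :
    ∃ m : N → M, IsChart L s m ∧ ∀ q : M, ∃ (x : N) (m' : N → M),
      IsChart L (insert x s) m' ∧ m' x = q ∧ Set.EqOn m' m s := by
  classical
  have h0 : SameType L ℵ₁ (PEmpty.elim : PEmpty.{w + 1} → N) (PEmpty.elim : PEmpty.{w + 1} → M) := h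
  have hs' : Cardinal.mk s < ℵ₁ := by
    rw [← Cardinal.succ_aleph0, Order.lt_succ_iff, Cardinal.le_aleph0_iff_set_countable]
    exact hs
  obtain ⟨t', ht'⟩ := h0.exists_extend hs' Subtype.val
  let m : N → M := fun x => if hx : x ∈ s then t' ⟨x, hx⟩ else Classical.arbitrary M
  have hm : ∀ x (hx : x ∈ s), m x = t' ⟨x, hx⟩ := fun x hx => dif_pos hx
  refine ⟨m, ht'.isChart fun x hx => ⟨.inr ⟨x, hx⟩, rfl, (hm x hx).symm⟩, fun q => ?_⟩
  have h1 : Cardinal.mk PUnit.{w + 1} < ℵ₁ := by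
    rw [Cardinal.mk_punit]
    exact Cardinal.one_lt_aleph0.trans_le (Cardinal.aleph0_le_aleph 1)
  -- The extension step is applied backwards, from M to N, to find a preimage of q.
  obtain ⟨b, hb⟩ := ht'.symm.exists_extend h1 fun _ => q
  have hb := hb.symm
  let x := b PUnit.unit
  have hxq : ∀ hx : x ∈ s, t' ⟨x, hx⟩ = q := fun hx =>
    (hb.eq_iff (.inl (.inr ⟨x, hx⟩)) (.inr PUnit.unit)).1 rfl
  refine ⟨x, Function.update m x q, hb.isChart ?_, Function.update_self .., fun y hy => ?_⟩
  · intro y hy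
    rcases eq_or_ne y x with rfl | hne
    · exact ⟨.inr PUnit.unit, rfl, (Function.update_self (f := m) ..).symm⟩
    · have hy' : y ∈ s := hy.resolve_left hne
      refine ⟨.inl (.inr ⟨y, hy'⟩), rfl, ?_⟩
      rw [Function.update_of_ne hne, hm y hy']
      rfl
  · rcases eq_or_ne y x with rfl | hne
    · rw [Function.update_self, hm _ hy, hxq]
    · rw [Function.update_of_ne hne]

end Charts

/-! ### Linear sections from finite charts -/

section LinearSection

variable {F : Type u} {E : Type v} {V : Type w} {W : Type x} [Field F]
  [AddCommGroup V] [Module F V] [AddCommGroup W] [Module F W]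

/-- A surjection onto a vector space from a set with relations that behave on finite subsets
like the graphs of the vector space operations has a section respecting these relations. -/
theorem exists_linear_section (A : E → E → E → Prop) (B : F → E → E → Prop) (π : E → V)
    (p : W →ₗ[F] V) (hA : ∀ x y, ∃ z, A x y z) (hB : ∀ e x, ∃ z, B e x z)
    (hπ : Function.Surjective π)
    (chart : ∀ s : Set E, s.Finite → ∃ m : E → W, Set.InjOn m s ∧ (∀ x ∈ s, p (m x) = π x) ∧
      (∀ x ∈ s, ∀ y ∈ s, ∀ z ∈ s, A x y z → m z = m x + m y) ∧
      ∀ e, ∀ x ∈ s, ∀ z ∈ s, B e x z → m z = e • m x) :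
    ∃ σ : V → E, (∀ y, π (σ y) = y) ∧ (∀ y z, A (σ y) (σ z) (σ (y + z))) ∧
      ∀ e y, B e (σ y) (σ (e • y)) := by
  choose add hadd using hA
  choose sm hsm using hB
  obtain ⟨x₀, -⟩ := hπ 0
  have chart' : ∀ s : Set E, s.Finite → ∃ m : E → W, Set.InjOn m s ∧ (∀ x ∈ s, p (m x) = π x) ∧
      (∀ x ∈ s, ∀ y ∈ s, add x y ∈ s → m (add x y) = m x + m y) ∧
      ∀ e, ∀ x ∈ s, sm e x ∈ s → m (sm e x) = e • m x := by
    intro s hs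
    obtain ⟨m, h1, h2, h3, h4⟩ := chart s hs
    exact ⟨m, h1, h2, fun x hx y hy h => h3 x hx y hy _ h (hadd x y),
      fun e x hx h => h4 e x hx _ h (hsm e x)⟩
  -- The selected operations make E a vector space. Each axiom is an equation about finitely many
  -- elements; a chart on the set of all its subterms is injective and turns it into the same
  -- equation in W. The zero is 0 · x₀, and charts show that x₀ does not matter.
  let _ : Add E := ⟨add⟩
  let _ : Zero E := ⟨sm 0 x₀⟩
  let _ : Neg E := ⟨sm (-1)⟩
  have hassoc : ∀ x y z : E, x + y + z = x + (y + z) := by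
    intro x y z
    change add (add x y) z = add x (add y z)
    obtain ⟨m, h1, h2, h3, h4⟩ := chart'
      {x, y, z, add x y, add y z, add (add x y) z, add x (add y z)} (by simp)
    apply h1 (by simp) (by simp)
    rw [h3 _ _ _ _ _, h3 _ _ _ _ _, h3 _ _ _ _ _, h3 _ _ _ _ _, add_assoc] <;> simp
  have hzero : ∀ x : E, 0 + x = x := by
    intro x
    change add (sm 0 x₀) x = x
    obtain ⟨m, h1, h2, h3, h4⟩ := chart' {x₀, sm 0 x₀, x, add (sm 0 x₀) x} (by simp)
    apply h1 (by simp) (by simp)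
    rw [h3 _ _ _ _ _, h4 _ _ _ _, zero_smul, zero_add] <;> simp
  have hneg : ∀ x : E, -x + x = 0 := by
    intro x
    change add (sm (-1) x) x = sm 0 x₀
    obtain ⟨m, h1, h2, h3, h4⟩ := chart'
      {x₀, x, sm (-1) x, sm 0 x₀, add (sm (-1) x) x} (by simp)
    apply h1 (by simp) (by simp)
    rw [h3 _ _ _ _ _, h4 _ _ _ _, h4 _ _ _ _, zero_smul, neg_smul, one_smul,
      neg_add_cancel] <;> simp
  have hcomm : ∀ x y : E, x + y = y + x := by
    intro x y
    change add x y = add y x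
    obtain ⟨m, h1, h2, h3, h4⟩ := chart' {x, y, add x y, add y x} (by simp)
    apply h1 (by simp) (by simp)
    rw [h3 _ _ _ _ _, h3 _ _ _ _ _, add_comm] <;> simp
  let ag : AddCommGroup E := { AddGroup.ofLeftAxioms hassoc hzero hneg with add_comm := hcomm }
  let mod : Module F E :=
    { smul := sm
      one_smul := by
        intro x
        change sm 1 x = x
        obtain ⟨m, h1, h2, h3, h4⟩ := chart' {x, sm 1 x} (by simp)
        apply h1 (by simp) (by simp)
        rw [h4 _ _ _ _, one_smul] <;> simp
      mul_smul := by
        intro c d x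
        change sm (c * d) x = sm c (sm d x)
        obtain ⟨m, h1, h2, h3, h4⟩ := chart' {x, sm d x, sm c (sm d x), sm (c * d) x} (by simp)
        apply h1 (by simp) (by simp)
        rw [h4 _ _ _ _, h4 _ _ _ _, h4 _ _ _ _, mul_smul] <;> simp
      smul_zero := by
        intro c
        change sm c (sm 0 x₀) = sm 0 x₀
        obtain ⟨m, h1, h2, h3, h4⟩ := chart' {x₀, sm 0 x₀, sm c (sm 0 x₀)} (by simp)
        apply h1 (by simp) (by simp)
        rw [h4 _ _ _ _, h4 _ _ _ _, zero_smul, smul_zero] <;> simp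
      zero_smul := by
        intro x
        change sm 0 x = sm 0 x₀
        obtain ⟨m, h1, h2, h3, h4⟩ := chart' {x₀, x, sm 0 x₀, sm 0 x} (by simp)
        apply h1 (by simp) (by simp)
        rw [h4 _ _ _ _, h4 _ _ _ _, zero_smul, zero_smul] <;> simp
      smul_add := by
        intro c x y
        change sm c (add x y) = add (sm c x) (sm c y)
        obtain ⟨m, h1, h2, h3, h4⟩ := chart'
          {x, y, add x y, sm c x, sm c y, sm c (add x y), add (sm c x) (sm c y)} (by simp)
        apply h1 (by simp) (by simp)
        rw [h4 _ _ _ _, h3 _ _ _ _ _, h3 _ _ _ _ _, h4 _ _ _ _, h4 _ _ _ _, smul_add] <;> simp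
      add_smul := by
        intro c d x
        change sm (c + d) x = add (sm c x) (sm d x)
        obtain ⟨m, h1, h2, h3, h4⟩ := chart'
          {x, sm c x, sm d x, sm (c + d) x, add (sm c x) (sm d x)} (by simp)
        apply h1 (by simp) (by simp)
        rw [h4 _ _ _ _, h3 _ _ _ _ _, h4 _ _ _ _, h4 _ _ _ _, add_smul] <;> simp }
  let pr : E →ₗ[F] V :=
    { toFun := π
      map_add' := by
        intro x y
        change π (add x y) = π x + π y
        obtain ⟨m, h1, h2, h3, h4⟩ := chart' {x, y, add x y} (by simp)
        rw [← h2 _ (by simp), ← h2 x (by simp), ← h2 y (by simp),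
          h3 x (by simp) y (by simp) (by simp), map_add]
      map_smul' := by
        intro c x
        change π (sm c x) = c • π x
        obtain ⟨m, h1, h2, h3, h4⟩ := chart' {x, sm c x} (by simp)
        rw [← h2 _ (by simp), ← h2 x (by simp), h4 c x (by simp) (by simp), map_smul] }
  -- A linear surjection of vector spaces splits.
  obtain ⟨σ, hσ⟩ := pr.exists_rightInverse_of_surjective (LinearMap.range_eq_top.2 hπ)
  refine ⟨σ, fun y => LinearMap.congr_fun hσ y, fun y z => ?_, fun e y => ?_⟩
  · rw [map_add]
    exact hadd _ _
  · rw [map_smul]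
    exact hsm _ _

end LinearSection

/-! ### Reconstruction of a colouring from an equivalent structure -/

section Reconstruction

open FirstOrder.Language.Structure (RelMap)

variable {F : Type u} [Field F] {S : Set Omega1} {η : LadderSystem F S} {D : Filter ℕ}
  {a b : Colouring F S} {N : Type u} [(Voc F S D).Structure N]

instance : Nonempty (CodedModel η D a) := ⟨.inr (0, 0)⟩

/-- Validity of a relation of the vocabulary of the coded models. -/
abbrev Holds {N : Type u} [(Voc F S D).Structure N] {k : ℕ} (R : VocRel F S D k)
    (p : Fin k → N) : Prop :=
  RelMap (L := Voc F S D) R p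

section IsChart

variable {s : Set N} {m : N → CodedModel η D a}

theorem IsChart.holds_iff (hm : IsChart (Voc F S D) s m)
    {k : ℕ} (R : VocRel F S D k) (p : Fin k → N) (hp : ∀ i, p i ∈ s) :
    codedRel η D a R (fun i => m (p i)) ↔ Holds R p :=
  hm.relMap_iff R p hp

theorem IsChart.vec_iff (hm : IsChart (Voc F S D) s m) {x : N} (hx : x ∈ s) {y : Vec F} :
    Holds (.vec y : VocRel F S D 1) ![x] ↔ ∃ c, m x = .inr (y, c) :=
  (hm.holds_iff (.vec y) ![x] (by simpa using hx)).symm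

theorem IsChart.ord_iff (hm : IsChart (Voc F S D) s m) {x : N} (hx : x ∈ s) {δ : S} :
    Holds (.ord δ : VocRel F S D 1) ![x] ↔ ∃ c, m x = .inl (δ, c) :=
  (hm.holds_iff (.ord δ) ![x] (by simpa using hx)).symm

theorem IsChart.addScalar_iff (hm : IsChart (Voc F S D) s m) {x z : N} (hx : x ∈ s) (hz : z ∈ s)
    {y : Vec F} {c e : F} (h : m x = .inr (y, c)) :
    Holds (.addScalar e : VocRel F S D 2) ![x, z] ↔ m z = .inr (y, c + e) := by
  rw [← hm.holds_iff (.addScalar e) ![x, z] (by simp [Fin.forall_fin_two, hx, hz])]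
  constructor
  · rintro ⟨y', c', h0, h1⟩
    cases h.symm.trans h0
    exact h1
  · exact fun h1 => ⟨y, c, h, h1⟩

theorem IsChart.addSeq_iff (hm : IsChart (Voc F S D) s m) {x z : N} (hx : x ∈ s) (hz : z ∈ s)
    {δ : S} {v e : NullSeq F D} (h : m x = .inl (δ, v)) :
    Holds (.addSeq e : VocRel F S D 2) ![x, z] ↔ m z = .inl (δ, v + e) := by
  rw [← hm.holds_iff (.addSeq e) ![x, z] (by simp [Fin.forall_fin_two, hx, hz])]
  constructor
  · rintro ⟨y', c', h0, h1⟩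
    cases h.symm.trans h0
    exact h1
  · exact fun h1 => ⟨δ, v, h, h1⟩

theorem IsChart.pr_iff (hm : IsChart (Voc F S D) s m) {x z : N} (hx : x ∈ s) (hz : z ∈ s)
    {δ : S} {v : NullSeq F D} {n : ℕ} (h : m x = .inl (δ, v)) :
    Holds (.pr n : VocRel F S D 2) ![x, z] ↔
      m z = .inr (η.ladder δ n, a δ n + v.1 n) := by
  rw [← hm.holds_iff (.pr n) ![x, z] (by simp [Fin.forall_fin_two, hx, hz])]
  constructor
  · rintro ⟨y', c', h0, h1⟩
    cases h.symm.trans h0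
    exact h1
  · exact fun h1 => ⟨δ, v, h, h1⟩

theorem IsChart.smul_iff (hm : IsChart (Voc F S D) s m) {x z : N} (hx : x ∈ s) (hz : z ∈ s)
    {y : Vec F} {c e : F} (h : m x = .inr (y, c)) :
    Holds (.smul e : VocRel F S D 2) ![x, z] ↔ m z = .inr (e • y, e * c) := by
  rw [← hm.holds_iff (.smul e) ![x, z] (by simp [Fin.forall_fin_two, hx, hz])]
  constructor
  · rintro ⟨y', c', h0, h1⟩
    cases h.symm.trans h0
    exact h1
  · exact fun h1 => ⟨y, c, h, h1⟩

theorem IsChart.add_iff (hm : IsChart (Voc F S D) s m) {x x' z : N} (hx : x ∈ s) (hx' : x' ∈ s)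
    (hz : z ∈ s) {y y' : Vec F} {c c' : F} (h : m x = .inr (y, c)) (h' : m x' = .inr (y', c')) :
    Holds (.add : VocRel F S D 3) ![x, x', z] ↔ m z = .inr (y + y', c + c') := by
  rw [← hm.holds_iff .add ![x, x', z] (by simp [Fin.forall_fin_succ, hx, hx', hz])]
  constructor
  · rintro ⟨y₁, y₂, c₁, c₂, h0, h1, h2⟩
    cases h.symm.trans h0
    cases h'.symm.trans h1
    exact h2
  · exact fun h1 => ⟨y, y', c, c', h, h', h1⟩

end IsChart

/-- The set of the elements over vectors. -/
abbrev VecPart (N : Type u) [(Voc F S D).Structure N] : Type u :=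
  {x : N // ∃ y : Vec F, Holds (.vec y : VocRel F S D 1) ![x]}

/-- A structure equivalent to a coded model has a linear section of its vector part. -/
theorem InfEquiv.exists_linear_section (h : InfEquiv (Voc F S D) ℵ₁ N (CodedModel η D a)) :
    ∃ σ : Vec F → N, (∀ y, Holds (.vec y : VocRel F S D 1) ![σ y]) ∧
      (∀ y z, Holds (.add : VocRel F S D 3) ![σ y, σ z, σ (y + z)]) ∧
      ∀ e y, Holds (.smul e : VocRel F S D 2) ![σ y, σ (e • y)] := by
  let π : VecPart (F := F) (S := S) (D := D) N → Vec F := fun x => x.2.choose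
  have hπ : ∀ x, Holds (.vec (π x) : VocRel F S D 1) ![x.1] := fun x => x.2.choose_spec
  have hin : ∀ x : VecPart (F := F) (S := S) (D := D) N, ∀ {s : Set N} {m : N → CodedModel η D a},
      IsChart (Voc F S D) s m → x.1 ∈ s → ∃ c, m x.1 = .inr (π x, c) :=
    fun x s m hm hx => (hm.vec_iff hx).1 (hπ x)
  have hA : ∀ x y : VecPart (F := F) (S := S) (D := D) N,
      ∃ z : VecPart (F := F) (S := S) (D := D) N, Holds (.add : VocRel F S D 3) ![x.1, y.1, z.1] := by
    intro x y
    obtain ⟨m, hm₀, hm⟩ := h.exists_isChart (s := {x.1, y.1}) (Set.to_countable _)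
    obtain ⟨c, hc⟩ := hin x hm₀ (by simp)
    obtain ⟨d, hd⟩ := hin y hm₀ (by simp)
    obtain ⟨z, m', hm', hz, heq⟩ := hm (.inr (π x + π y, c + d))
    refine ⟨⟨z, _, (hm'.vec_iff (by simp)).2 ⟨_, hz⟩⟩, ?_⟩
    exact (hm'.add_iff (by simp) (by simp) (by simp) ((heq (by simp)).trans hc)
      ((heq (by simp)).trans hd)).2 hz
  have hB : ∀ (e : F) (x : VecPart (F := F) (S := S) (D := D) N),
      ∃ z : VecPart (F := F) (S := S) (D := D) N,
        Holds (.smul e : VocRel F S D 2) ![x.1, z.1] := by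
    intro e x
    obtain ⟨m, hm₀, hm⟩ := h.exists_isChart (s := {x.1}) (Set.to_countable _)
    obtain ⟨c, hc⟩ := hin x hm₀ (by simp)
    obtain ⟨z, m', hm', hz, heq⟩ := hm (.inr (e • π x, e * c))
    refine ⟨⟨z, _, (hm'.vec_iff (by simp)).2 ⟨_, hz⟩⟩, ?_⟩
    exact (hm'.smul_iff (by simp) (by simp) ((heq (by simp)).trans hc)).2 hz
  have hsurj : Function.Surjective π := by
    intro y
    obtain ⟨m, -, hm⟩ := h.exists_isChart (s := ∅) (Set.to_countable _)
    obtain ⟨x, m', hm', hx, -⟩ := hm (.inr (y, 0))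
    have hxs : x ∈ insert x (∅ : Set N) := by simp
    let x' : VecPart (F := F) (S := S) (D := D) N := ⟨x, y, (hm'.vec_iff hxs).2 ⟨0, hx⟩⟩
    obtain ⟨c, hc⟩ := hin x' hm' hxs
    refine ⟨x', ?_⟩
    exact (congrArg Prod.fst (Sum.inr_injective (hx.symm.trans hc))).symm
  obtain ⟨σ, h1, h2, h3⟩ := LadderModels.exists_linear_section (F := F) (W := Vec F × F)
    (fun x y z : VecPart (F := F) (S := S) (D := D) N =>
      Holds (.add : VocRel F S D 3) ![x.1, y.1, z.1])
    (fun e x z => Holds (.smul e : VocRel F S D 2) ![x.1, z.1]) π (LinearMap.fst F (Vec F) F)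
    hA hB hsurj fun s hs => by
      obtain ⟨m, hm, -⟩ := h.exists_isChart (s := Subtype.val '' s) (hs.image _).countable
      have hmem : ∀ x ∈ s, x.1 ∈ Subtype.val '' s := fun x hx => ⟨x, hx, rfl⟩
      -- On the part over vectors a chart takes values in `Vec F × F`, whose vector space operations
      -- are the interpretations of `add` and `smul`; the value 0 elsewhere is a dummy.
      let ρ : VecPart (F := F) (S := S) (D := D) N → Vec F × F := fun x => Sum.elim 0 id (m x.1)
      have hρ : ∀ x ∈ s, m x.1 = .inr (ρ x) ∧ (ρ x).1 = π x := by
        intro x hx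
        obtain ⟨c, hc⟩ := hin x hm (hmem x hx)
        have : ρ x = (π x, c) := by simp only [ρ, hc, Sum.elim_inr, id]
        exact ⟨by rw [hc, this], by rw [this]⟩
      refine ⟨ρ, fun x hx y hy hxy => ?_, fun x hx => (hρ x hx).2, fun x hx y hy z hz hxyz => ?_,
        fun e x hx z hz hxz => ?_⟩
      · refine Subtype.ext (hm.injOn (hmem x hx) (hmem y hy) ?_)
        rw [(hρ x hx).1, (hρ y hy).1, hxy]
      · exact Sum.inr_injective ((hρ z hz).1.symm.trans ((hm.add_iff (hmem x hx) (hmem y hy)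
          (hmem z hz) (hρ x hx).1 (hρ y hy).1).1 hxyz))
      · exact Sum.inr_injective ((hρ z hz).1.symm.trans ((hm.smul_iff (hmem x hx)
          (hmem z hz) (hρ x hx).1).1 hxz))
  refine ⟨fun y => (σ y).1, fun y => ?_, h2, h3⟩
  have := hπ (σ y)
  rwa [h1] at this

/-- A frame of a structure consists of a linear section of the part over vectors, a section of the
part over `S`, and the parametrization determined by them; `b` describes the projections of
the latter section. -/
structure IsFrame (η : LadderSystem F S) (b : Colouring F S) (σ : Vec F → N) (t : S → N)
    (G : (S × NullSeq F D) ⊕ (Vec F × F) → N) : Prop where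
  vec : ∀ y, Holds (.vec y : VocRel F S D 1) ![σ y]
  add : ∀ y z, Holds (.add : VocRel F S D 3) ![σ y, σ z, σ (y + z)]
  smul : ∀ e y, Holds (.smul e : VocRel F S D 2) ![σ y, σ (e • y)]
  ord : ∀ δ, Holds (.ord δ : VocRel F S D 1) ![t δ]
  inl : ∀ δ v, Holds (.addSeq v : VocRel F S D 2) ![t δ, G (.inl (δ, v))]
  inr : ∀ y c, Holds (.addScalar c : VocRel F S D 2) ![σ y, G (.inr (y, c))]
  pr : ∀ δ n, Holds (.pr n : VocRel F S D 2) ![t δ, G (.inr (η.ladder δ n, b δ n))]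

/-- The origins over vectors must be chosen linearly, those over S are arbitrary; charts supply
their translates. The colouring b records how far the n-th projection of t δ lies from the origin of
its fibre. -/
theorem InfEquiv.exists_isFrame (h : InfEquiv (Voc F S D) ℵ₁ N (CodedModel η D a)) :
    ∃ (b : Colouring F S) (σ : Vec F → N) (t : S → N)
      (G : (S × NullSeq F D) ⊕ (Vec F × F) → N), IsFrame η b σ t G := by
  obtain ⟨σ, hσ, hadd, hsmul⟩ := h.exists_linear_section
  have ht : ∀ δ : S, ∃ x : N, Holds (.ord δ : VocRel F S D 1) ![x] := by
    intro δ
    obtain ⟨m, -, hm⟩ := h.exists_isChart (s := ∅) (Set.to_countable _)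
    obtain ⟨x, m', hm', hx, -⟩ := hm (.inl (δ, 0))
    exact ⟨x, (hm'.ord_iff (by simp)).2 ⟨_, hx⟩⟩
  choose t ht using ht
  have hinr : ∀ (y : Vec F) (c : F), ∃ x : N, Holds (.addScalar c : VocRel F S D 2) ![σ y, x] := by
    intro y c
    obtain ⟨m, hm₀, hm⟩ := h.exists_isChart (s := {σ y}) (Set.to_countable _)
    obtain ⟨g, hg⟩ := (hm₀.vec_iff (by simp)).1 (hσ y)
    obtain ⟨x, m', hm', hx, heq⟩ := hm (.inr (y, g + c))
    exact ⟨x, (hm'.addScalar_iff (by simp) (by simp) ((heq (by simp)).trans hg)).2 hx⟩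
  have hinl : ∀ (δ : S) (v : NullSeq F D), ∃ x : N,
      Holds (.addSeq v : VocRel F S D 2) ![t δ, x] := by
    intro δ v
    obtain ⟨m, hm₀, hm⟩ := h.exists_isChart (s := {t δ}) (Set.to_countable _)
    obtain ⟨g, hg⟩ := (hm₀.ord_iff (by simp)).1 (ht δ)
    obtain ⟨x, m', hm', hx, heq⟩ := hm (.inl (δ, g + v))
    exact ⟨x, (hm'.addSeq_iff (by simp) (by simp) ((heq (by simp)).trans hg)).2 hx⟩
  choose Gr hGr using hinr
  choose Gl hGl using hinl
  have hpr : ∀ (δ : S) (n : ℕ), ∃ c : F,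
      Holds (.pr n : VocRel F S D 2) ![t δ, Gr (η.ladder δ n) c] := by
    intro δ n
    obtain ⟨m, hm₀, hm⟩ := h.exists_isChart (s := {t δ, σ (η.ladder δ n)}) (Set.to_countable _)
    obtain ⟨w, hw⟩ := (hm₀.ord_iff (by simp)).1 (ht δ)
    obtain ⟨g, hg⟩ := (hm₀.vec_iff (by simp)).1 (hσ (η.ladder δ n))
    obtain ⟨x, m', hm', hx, heq⟩ := hm (.inr (η.ladder δ n, a δ n + w.1 n))
    have h1 := (hm'.pr_iff (z := x) (by simp) (by simp) ((heq (by simp)).trans hw)).2 hx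
    have h2 := (hm'.addScalar_iff (z := x) (e := a δ n + w.1 n - g) (by simp) (by simp)
      ((heq (by simp)).trans hg)).2 (by rw [hx, add_sub_cancel])
    -- In the chart the projection of t δ has height a δ n + w(n) and the origin of its fibre has
    -- height g. The next chart contains both x and the selected translate by the difference, and
    -- shows that they coincide.
    refine ⟨a δ n + w.1 n - g, ?_⟩
    obtain ⟨m₂, hm₂, -⟩ := h.exists_isChart
      (s := {σ (η.ladder δ n), x, Gr (η.ladder δ n) (a δ n + w.1 n - g)}) (Set.to_countable _)
    obtain ⟨g', hg'⟩ := (hm₂.vec_iff (by simp)).1 (hσ (η.ladder δ n))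
    have h3 := (hm₂.addScalar_iff (by simp) (by simp) hg').1 h2
    have h4 := (hm₂.addScalar_iff (by simp) (by simp) hg').1
      (hGr (η.ladder δ n) (a δ n + w.1 n - g))
    rwa [← hm₂.injOn (by simp) (by simp) (h3.trans h4.symm)]
  choose b hb using hpr
  exact ⟨b, σ, t, Sum.elim (fun p => Gl p.1 p.2) fun p => Gr p.1 p.2, hσ, hadd, hsmul, ht, hGl,
    hGr, hb⟩

section IsFrame

variable {σ : Vec F → N} {t : S → N} {G : (S × NullSeq F D) ⊕ (Vec F × F) → N}

/-- A chart places the origins at heights g and w, which depend on the chart, and the frame at the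
corresponding translates. The set X makes room for further elements of N. -/
theorem IsFrame.exists_isChart (hG : IsFrame η b σ t G)
    (h : InfEquiv (Voc F S D) ℵ₁ N (CodedModel η D a)) {X : Set N} (hX : X.Countable)
    {P : Set ((S × NullSeq F D) ⊕ (Vec F × F))} (hP : P.Countable) :
    ∃ (s : Set N) (m : N → CodedModel η D a) (g : Vec F → F) (w : S → NullSeq F D),
      IsChart (Voc F S D) s m ∧ X ⊆ s ∧
      (∀ δ v, .inl (δ, v) ∈ P → t δ ∈ s ∧ G (.inl (δ, v)) ∈ s ∧
        m (t δ) = .inl (δ, w δ) ∧ m (G (.inl (δ, v))) = .inl (δ, w δ + v)) ∧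
      ∀ y c, .inr (y, c) ∈ P → σ y ∈ s ∧ G (.inr (y, c)) ∈ s ∧
        m (σ y) = .inr (y, g y) ∧ m (G (.inr (y, c))) = .inr (y, g y + c) := by
  let base : (S × NullSeq F D) ⊕ (Vec F × F) → N := Sum.elim (fun p => t p.1) fun p => σ p.1
  obtain ⟨m, hm, -⟩ := h.exists_isChart (s := X ∪ (G '' P ∪ base '' P))
    (hX.union ((hP.image G).union (hP.image base)))
  let g : Vec F → F := fun y => Sum.elim (fun _ => 0) Prod.snd (m (σ y))
  let w : S → NullSeq F D := fun δ => Sum.elim Prod.snd (fun _ => 0) (m (t δ))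
  refine ⟨_, m, g, w, hm, Set.subset_union_left, fun δ v hp => ?_, fun y c hp => ?_⟩
  · have h1 : t δ ∈ X ∪ (G '' P ∪ base '' P) := .inr (.inr ⟨_, hp, rfl⟩)
    have h2 : G (.inl (δ, v)) ∈ X ∪ (G '' P ∪ base '' P) := .inr (.inl ⟨_, hp, rfl⟩)
    obtain ⟨w', hw⟩ := (hm.ord_iff h1).1 (hG.ord δ)
    have hw' : w δ = w' := congrArg (Sum.elim Prod.snd fun _ => 0) hw
    rw [hw']
    exact ⟨h1, h2, hw, (hm.addSeq_iff h1 h2 hw).1 (hG.inl δ v)⟩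
  · have h1 : σ y ∈ X ∪ (G '' P ∪ base '' P) := .inr (.inr ⟨_, hp, rfl⟩)
    have h2 : G (.inr (y, c)) ∈ X ∪ (G '' P ∪ base '' P) := .inr (.inl ⟨_, hp, rfl⟩)
    obtain ⟨g', hg⟩ := (hm.vec_iff h1).1 (hG.vec y)
    have hg' : g y = g' := congrArg (Sum.elim (fun _ => 0) Prod.snd) hg
    rw [hg']
    exact ⟨h1, h2, hg, (hm.addScalar_iff h1 h2 hg).1 (hG.inr y c)⟩

theorem IsFrame.bijective (hG : IsFrame η b σ t G)
    (h : InfEquiv (Voc F S D) ℵ₁ N (CodedModel η D a)) : Function.Bijective G := by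
  constructor
  · intro p q hpq
    obtain ⟨s, m, g, w, hm, -, hl, hr⟩ :=
      hG.exists_isChart h Set.countable_empty (P := {p, q}) (Set.to_countable _)
    rcases p with ⟨δ, v⟩ | ⟨y, c⟩ <;> rcases q with ⟨δ', v'⟩ | ⟨y', c'⟩
    · have h1 := (hl δ v (by simp)).2.2.2
      rw [hpq, (hl δ' v' (by simp)).2.2.2] at h1
      obtain ⟨rfl, h2⟩ := Prod.mk.inj (Sum.inl_injective h1)
      rw [add_left_cancel h2]
    · have h1 := (hl δ v (by simp)).2.2.2
      rw [hpq, (hr y' c' (by simp)).2.2.2] at h1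
      cases h1
    · have h1 := (hr y c (by simp)).2.2.2
      rw [hpq, (hl δ' v' (by simp)).2.2.2] at h1
      cases h1
    · have h1 := (hr y c (by simp)).2.2.2
      rw [hpq, (hr y' c' (by simp)).2.2.2] at h1
      obtain ⟨rfl, h2⟩ := Prod.mk.inj (Sum.inr_injective h1)
      rw [add_left_cancel h2]
  · intro x
    obtain ⟨m₀, hm₀, -⟩ := h.exists_isChart (s := {x}) (Set.to_countable _)
    rcases hx₀ : m₀ x with ⟨δ, v⟩ | ⟨y, c⟩
    · have hx := (hm₀.ord_iff (x := x) (by simp)).2 ⟨v, hx₀⟩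
      -- A first chart determines the translation that carries the origin t δ to x. This is a
      -- relation in N, independent of the chart, so a second chart containing the corresponding
      -- value of G identifies that value with x.
      obtain ⟨s, m, g, w, hm, hxs, hl, -⟩ := hG.exists_isChart h (X := {x}) (Set.to_countable _)
        (P := {.inl (δ, 0)}) (Set.to_countable _)
      obtain ⟨h1, -, h2, -⟩ := hl δ 0 rfl
      obtain ⟨v, hv⟩ := (hm.ord_iff (hxs rfl)).1 hx
      have h3 := (hm.addSeq_iff (e := v - w δ) h1 (hxs rfl) h2).2 (by rw [hv, add_sub_cancel])
      obtain ⟨s', m', g', w', hm', hxs', hl', -⟩ := hG.exists_isChart h (X := {x})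
        (Set.to_countable _) (P := {.inl (δ, v - w δ)}) (Set.to_countable _)
      obtain ⟨h4, h5, h6, h7⟩ := hl' δ _ rfl
      exact ⟨_, hm'.injOn h5 (hxs' rfl)
        (h7.trans ((hm'.addSeq_iff h4 (hxs' rfl) h6).1 h3).symm)⟩
    · have hx := (hm₀.vec_iff (x := x) (by simp)).2 ⟨c, hx₀⟩
      obtain ⟨s, m, g, w, hm, hxs, -, hr⟩ := hG.exists_isChart h (X := {x}) (Set.to_countable _)
        (P := {.inr (y, 0)}) (Set.to_countable _)
      obtain ⟨h1, -, h2, -⟩ := hr y 0 rfl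
      obtain ⟨c, hc⟩ := (hm.vec_iff (hxs rfl)).1 hx
      have h3 := (hm.addScalar_iff (e := c - g y) h1 (hxs rfl) h2).2 (by rw [hc, add_sub_cancel])
      obtain ⟨s', m', g', w', hm', hxs', -, hr'⟩ := hG.exists_isChart h (X := {x})
        (Set.to_countable _) (P := {.inr (y, c - g y)}) (Set.to_countable _)
      obtain ⟨h4, h5, h6, h7⟩ := hr' y _ rfl
      exact ⟨_, hm'.injOn h5 (hxs' rfl)
        (h7.trans ((hm'.addScalar_iff h4 (hxs' rfl) h6).1 h3).symm)⟩

/-- On countable sets, a frame is a translation followed by the inverse of a chart. -/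
theorem IsFrame.exists_translation (hG : IsFrame η b σ t G)
    (h : InfEquiv (Voc F S D) ℵ₁ N (CodedModel η D a))
    {P : Set ((S × NullSeq F D) ⊕ (Vec F × F))} (hP : P.Countable) :
    ∃ (g : Vec F → F) (w : S → NullSeq F D),
      (∀ {k : ℕ} (R : VocRel F S D k) (p : Fin k → (S × NullSeq F D) ⊕ (Vec F × F)),
        (∀ i, p i ∈ P) → (Holds R (fun i => G (p i)) ↔ codedRel η D a R fun i =>
          Sum.map (fun q => (q.1, w q.1 + q.2)) (fun q => (q.1, g q.1 + q.2)) (p i))) ∧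
      (∀ y z c d e, .inr (y, c) ∈ P → .inr (z, d) ∈ P → .inr (y + z, e) ∈ P →
        g (y + z) = g y + g z) ∧
      (∀ e y c d, .inr (y, c) ∈ P → .inr (e • y, d) ∈ P → g (e • y) = e * g y) ∧
      ∀ δ v n, .inl (δ, v) ∈ P → .inr (η.ladder δ n, b δ n) ∈ P →
        g (η.ladder δ n) + b δ n = a δ n + (w δ).1 n := by
  obtain ⟨s, m, g, w, hm, -, hl, hr⟩ := hG.exists_isChart h Set.countable_empty hP
  refine ⟨g, w, fun R p hp => ?_, fun y z c d e hy hz hyz => ?_, fun e y c d hy hz => ?_,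
    fun δ v n hδ hn => ?_⟩
  · have key : ∀ i, G (p i) ∈ s ∧ m (G (p i)) =
        Sum.map (fun q => (q.1, w q.1 + q.2)) (fun q => (q.1, g q.1 + q.2)) (p i) := by
      intro i
      have hi := hp i
      generalize p i = q at hi ⊢
      rcases q with ⟨δ, v⟩ | ⟨y, c⟩
      · exact ⟨(hl δ v hi).2.1, (hl δ v hi).2.2.2⟩
      · exact ⟨(hr y c hi).2.1, (hr y c hi).2.2.2⟩
    rw [← hm.holds_iff R _ fun i => (key i).1]
    exact iff_of_eq (congrArg _ (funext fun i => (key i).2))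
  · have h1 := (hm.add_iff (hr y c hy).1 (hr z d hz).1 (hr _ e hyz).1 (hr y c hy).2.2.1
      (hr z d hz).2.2.1).1 (hG.add y z)
    exact (Prod.mk.inj (Sum.inr_injective ((hr _ e hyz).2.2.1.symm.trans h1))).2
  · have h1 := (hm.smul_iff (hr y c hy).1 (hr _ d hz).1 (hr y c hy).2.2.1).1 (hG.smul e y)
    exact (Prod.mk.inj (Sum.inr_injective ((hr _ d hz).2.2.1.symm.trans h1))).2
  · have h1 := (hm.pr_iff (hl δ v hδ).1 (hr _ _ hn).2.1 (hl δ v hδ).2.2.1).1 (hG.pr δ n)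
    exact (Prod.mk.inj (Sum.inr_injective ((hr _ _ hn).2.2.2.symm.trans h1))).2

/-- Seen in a chart, the frame is a translation into the model of a, and on the relevant countable
set the amounts g and w satisfy the identities that make a translation carry the relations for b to
those for a. -/
theorem IsFrame.holds_iff (hG : IsFrame η b σ t G)
    (h : InfEquiv (Voc F S D) ℵ₁ N (CodedModel η D a)) {k : ℕ} (R : VocRel F S D k)
    (p : Fin k → (S × NullSeq F D) ⊕ (Vec F × F)) :
    Holds R (fun i => G (p i)) ↔ codedRel η D b R p := by
  -- Besides the tuple itself, P contains the projections of its elements over S, because the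
  -- identity relating a and b is needed there.
  obtain ⟨g, w, hR, hadd, hsmul, hpr⟩ := hG.exists_translation h
    (P := Set.range p ∪ {q | ∃ δ v n, .inl (δ, v) ∈ Set.range p ∧
      q = .inr (η.ladder δ n, b δ n)}) <| by
    refine (Set.countable_range p).union ?_
    refine Set.Countable.mono (s₂ := ⋃ x ∈ Set.range p, Set.range fun n : ℕ =>
      Sum.elim (fun q : S × NullSeq F D => .inr (η.ladder q.1 n, b q.1 n)) .inr x) ?_
      ((Set.countable_range p).biUnion fun _ _ => Set.countable_range _)
    rintro _ ⟨δ, v, n, hv, rfl⟩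
    exact Set.mem_iUnion₂.2 ⟨_, hv, n, rfl⟩
  have hp : ∀ i q, p i = q → q ∈ Set.range p ∪ {q | ∃ δ v n, .inl (δ, v) ∈ Set.range p ∧
      q = .inr (η.ladder δ n, b δ n)} := fun i q hi => .inl ⟨i, hi⟩
  rw [hR R p fun i => hp i _ rfl]
  cases R with
  | vec y => rcases h0 : p 0 with ⟨δ, s⟩ | ⟨z, c⟩ <;> simp [codedRel, h0]
  | ord δ =>
    rcases h0 : p 0 with ⟨δ', s⟩ | ⟨z, c⟩
    · rw [codedRel_ord, codedRel_ord, h0, Sum.map_inl]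
      constructor <;> rintro ⟨_, h⟩ <;> cases h <;> exact ⟨_, rfl⟩
    · simp [codedRel, h0]
  | pr n =>
    rcases h0 : p 0 with ⟨δ, s⟩ | ⟨y, c⟩ <;> rcases h1 : p 1 with ⟨δ', s'⟩ | ⟨z, c'⟩ <;>
      try simp [codedRel, h0, h1]
    rintro rfl
    have := hpr δ s n (hp 0 _ h0) (.inr ⟨δ, s, n, ⟨0, h0⟩, rfl⟩)
    constructor <;> intro h
    · linear_combination h - this
    · linear_combination h + this
  | addScalar e =>
    rcases h0 : p 0 with ⟨δ, s⟩ | ⟨y, c⟩ <;> rcases h1 : p 1 with ⟨δ', s'⟩ | ⟨z, c'⟩ <;>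
      try simp [codedRel, h0, h1]
    rintro rfl
    rw [add_assoc, add_right_inj]
  | addSeq t =>
    rcases h0 : p 0 with ⟨δ, s⟩ | ⟨y, c⟩ <;> rcases h1 : p 1 with ⟨δ', s'⟩ | ⟨z, c'⟩
    · rw [codedRel_addSeq h0 h1, codedRel_addSeq ((congrArg _ h0).trans (Sum.map_inl ..))
        ((congrArg _ h1).trans (Sum.map_inl ..))]
      refine and_congr_right ?_
      rintro rfl
      rw [add_assoc, add_right_inj]
    all_goals simp [codedRel, h0, h1]
  | add =>
    rcases h0 : p 0 with ⟨δ, s⟩ | ⟨y, c⟩ <;> rcases h1 : p 1 with ⟨δ', s'⟩ | ⟨z, c'⟩ <;>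
      rcases h2 : p 2 with ⟨δ'', s''⟩ | ⟨w, c''⟩ <;> try simp [codedRel, h0, h1, h2]
    rintro rfl
    rw [hadd y z _ _ _ (hp 0 _ h0) (hp 1 _ h1) (hp 2 _ h2)]
    constructor <;> intro h <;> linear_combination h
  | smul e =>
    rcases h0 : p 0 with ⟨δ, s⟩ | ⟨y, c⟩ <;> rcases h1 : p 1 with ⟨δ', s'⟩ | ⟨z, c'⟩ <;>
      try simp [codedRel, h0, h1]
    rintro rfl
    rw [hsmul e y _ _ (hp 0 _ h0) (hp 1 _ h1)]
    constructor <;> intro h <;> linear_combination h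

end IsFrame

/-- A structure equivalent to a coded model is isomorphic to a coded model. -/
theorem InfEquiv.exists_equiv (h : InfEquiv (Voc F S D) ℵ₁ N (CodedModel η D a)) :
    ∃ b : Colouring F S, Nonempty (N ≃[Voc F S D] CodedModel η D b) := by
  obtain ⟨b, σ, t, G, hG⟩ := h.exists_isFrame
  let φ : CodedModel η D b ≃[Voc F S D] N :=
    { toEquiv := Equiv.ofBijective G (hG.bijective h)
      map_fun' := fun g => nomatch g
      map_rel' := fun R p => hG.holds_iff h R p }
  exact ⟨b, ⟨φ.symm⟩⟩

end Reconstruction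

/-! ### Counting isomorphism classes -/

section Counting

variable {F : Type u} [Field F] {S : Set Omega1} {η : LadderSystem F S} {D : Filter ℕ}

/-- The number of structures equivalent to a coded model is the number of equivalence classes of
colourings. -/
theorem no_codedModel (hD : ∀ I : Set ℕ, Iᶜ.Finite → I ∈ D) (a : Colouring F S)
    (ha : Cardinal.mk (CodedModel η D a) = ℵ₁) :
    No (Voc F S D) (CodedModel η D a) =
      Cardinal.lift.{u + 1} (Cardinal.mk (Colouring F S ⧸ Unif η D)) := by
  let cls : Colouring F S → Quotient (FirstOrder.Language.equivSetoid (L := Voc F S D)) :=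
    fun b => Quotient.mk _ (CategoryTheory.Bundled.of (CodedModel η D b))
  have hcls : ∀ b c, cls b = cls c ↔ ColEquiv η D b c := fun b c =>
    Quotient.eq.trans ⟨fun ⟨φ⟩ => colEquiv_of_equiv φ, nonempty_equiv_of_colEquiv⟩
  let f : Colouring F S ⧸ Unif η D →
      Quotient (FirstOrder.Language.equivSetoid (L := Voc F S D)) := fun q =>
    Quotient.liftOn' q cls fun b c hbc =>
      (hcls b c).2 ((Submodule.quotientRel_def _).1 hbc)
  have hf : Function.Injective f := by
    rintro ⟨b⟩ ⟨c⟩ hbc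
    exact (Submodule.Quotient.eq _).2 ((hcls b c).1 hbc)
  have hset : {c : Quotient (FirstOrder.Language.equivSetoid (L := Voc F S D)) |
      ∃ N : CategoryTheory.Bundled.{u} (Voc F S D).Structure,
        c = Quotient.mk _ N ∧ Cardinal.mk N = Cardinal.mk (CodedModel η D a) ∧
          InfEquiv (Voc F S D) (Cardinal.mk (CodedModel η D a)) N (CodedModel η D a)} =
      Set.range f := by
    rw [ha]
    ext c
    constructor
    · rintro ⟨N, rfl, -, hN⟩
      obtain ⟨b, ⟨φ⟩⟩ := hN.exists_equiv
      exact ⟨Submodule.Quotient.mk b, Quotient.sound ⟨φ.symm⟩⟩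
    · rintro ⟨⟨b⟩, rfl⟩
      -- The domain does not depend on the colouring, so `ha` is also the cardinality of the model
      -- of b.
      exact ⟨_, rfl, ha, infEquiv_codedModel hD a b⟩
  have h := Cardinal.mk_range_eq_of_injective hf
  rw [Cardinal.lift_id'.{u, u + 1}] at h
  rw [No, hset, h]

end Counting

end LadderModels

theorem mainTheorem3 {F : Type u} [Field F] (S : Set Omega1)
    (hS : ∀ δ ∈ S, Order.IsSuccLimit δ) (D : Filter ℕ) (hD : ∀ I : Set ℕ, Iᶜ.Finite → I ∈ D)
    (η : LadderSystem F S) :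
    (∀ a b : Colouring F S,
      Nonempty (CodedModel η D a ≃[Voc F S D] CodedModel η D b) ↔ ColEquiv η D a b) ∧
    (∀ (N : Type u) [(Voc F S D).Structure N] (a : Colouring F S),
      Cardinal.mk N = ℵ₁ → InfEquiv (Voc F S D) ℵ₁ N (CodedModel η D a) →
        ∃ b : Colouring F S, Nonempty (N ≃[Voc F S D] CodedModel η D b)) ∧
    (∀ a : Colouring F S, Cardinal.mk (CodedModel η D a) = ℵ₁ →
      No (Voc F S D) (CodedModel η D a)
        = Cardinal.lift.{u + 1} (Cardinal.mk (Colouring F S ⧸ Unif η D))) :=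
  ⟨fun _ _ => ⟨fun ⟨φ⟩ => colEquiv_of_equiv φ, nonempty_equiv_of_colEquiv⟩,
    fun _ _ _ _ h => h.exists_equiv, fun a ha => no_codedModel hD a ha⟩
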